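/- Let $k$ be a field of characteristic $0$, let $A$ be a smooth $k$-algebra which is an integral domain, and let $B$ be an integral domain containing $A$ and finite as an $A$-module. Let $K\subseteq L$ be the fraction fields of $A$ and $B$, and let $\Omega^{\bullet}_{A/k}=\bigwedge_A^{\bullet}\Omega^1_{A/k}$ and $\Omega^{\bullet}_{B/k}=\bigwedge_B^{\bullet}\Omega^1_{B/k}$ be the graded algebras of Kähler differential forms. Then there is a unique additive map $$\mathrm{Tr}_{B/A}:\ \Omega^{\bullet}_{B/k}\otimes_B L\longrightarrow \Omega^{\bullet}_{A/k}\otimes_A K$$ which in degree $0$ is the usual trace $\mathrm{Tr}_{L/K}:L\to K$ and which is $\Omega^{\bullet}_{A/k}$-linear, that is, $\mathrm{Tr}_{B/A}(\omega\wedge\eta)=\omega\wedge\mathrm{Tr}_{B/A}(\eta)$ for all $\omega\in\Omega^{\bullet}_{A/k}$ (acting on the source through the pullback $\Omega^{\bullet}_{A/k}\to\Omega^{\bullet}_{B/k}$) and all $\eta\in\Omega^{\bullet}_{B/k}\otimes_B L$. Moreover, this map sends regular forms to regular forms: for every $n\ge 0$, it maps the image of $\Omega^{n}_{B/k}$ in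 $\Omega^{\bullet}_{B/k}\otimes_B L$ into the image of $\Omega^{n}_{A/k}$ in $\Omega^{\bullet}_{A/k}\otimes_A K$. -/

import Mathlib

open scoped TensorProduct

noncomputable section

/-- The graded algebra `Ω^•_{A/k}` of algebraic differential forms of `A` over `k`: the exterior
algebra over `A` of the module of Kähler differentials. Its degree-`n` part `Ω^n_{A/k}` is the
submodule `⋀[A]^n Ω[A⁄k]`, and its product is the wedge product. -/
abbrev DiffForms (k A : Type*) [CommRing k] [CommRing A] [Algebra k A] : Type _ :=
  ExteriorAlgebra A (Ω[A⁄k])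

/-- The algebra `K ⊗_A Ω^•_{A/k}`; when `K` is the fraction field of `A`, these are the
meromorphic forms of `A`. -/
abbrev MeroForms (k A K : Type*) [CommRing k] [CommRing A] [Algebra k A] [Field K]
    [Algebra A K] : Type _ :=
  K ⊗[A] DiffForms k A

/-- The pullback `Ω^•_{A/k} → Ω^•_{B/k}` of forms along `A → B`: the morphism of `A`-algebras
with `d a ↦ d (algebraMap A B a)`. -/
def DiffForms.pullback (k A B : Type*) [CommRing k] [CommRing A] [CommRing B] [Algebra k A]
    [Algebra k B] [Algebra A B] [IsScalarTower k A B] : DiffForms k A →ₐ[A] DiffForms k B :=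
  ExteriorAlgebra.lift A
    ⟨(ExteriorAlgebra.ι B).restrictScalars A ∘ₗ KaehlerDifferential.map k k A B,
      fun m => ExteriorAlgebra.ι_sq_zero (KaehlerDifferential.map k k A B m)⟩

/-- The two properties that characterize the trace
`Tr_{B/A} : L ⊗_B Ω^•_{B/k} → K ⊗_A Ω^•_{A/k}` on meromorphic forms. -/
structure IsFormTrace (k A B K L : Type*) [CommRing k] [CommRing A] [CommRing B]
    [Algebra k A] [Algebra k B] [Algebra A B] [IsScalarTower k A B]
    [Field K] [Field L] [Algebra A K] [Algebra B L] [Algebra K L]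
    (Tr : MeroForms k B L →+ MeroForms k A K) : Prop where
  /-- In degree `0` it is the usual trace from `L` to `K`. -/
  degree_zero : ∀ l : L, Tr (l ⊗ₜ[B] (1 : DiffForms k B)) =
    Algebra.trace K L l ⊗ₜ[A] (1 : DiffForms k A)
  /-- It is linear over `Ω^•_{A/k}`: `Tr (ω ∧ η) = ω ∧ Tr η`. -/
  map_wedge : ∀ (ω : DiffForms k A) (η : MeroForms k B L),
    Tr (((1 : L) ⊗ₜ[B] DiffForms.pullback k A B ω) * η) = ((1 : K) ⊗ₜ[A] ω) * Tr η

end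

set_option linter.unusedSectionVars false

noncomputable section

/-! ### Odd and even elements of a noncommutative ring: powers, signs, anticommutators. -/

section NoncommRing

variable {E : Type*} [Ring E]

/-! In characteristic 0 the extension `L/K` is separable, so `K → L` is formally étale, as are the
localizations `A → K` and `B → L`. Forms commute with formally étale base change, hence L ⊗_B Ω_B ≅
Ω_L ≅ L ⊗_K Ω_K, and the trace is Tr_{L/K} ⊗ id. Uniqueness is formal: meromorphic forms of `B` are
sums of elements l ⊗ ω with ω pulled back from `A`, and on these the two axioms fix the value.

Regularity is the real content. `A` is noetherian and normal (`isIntegrallyClosed_of_smooth`) and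
its forms are a projective module, so it is enough to work at the primes p where S = A_p is a
principal ideal domain (`exists_eq_one_tmul_of_forall_prime`). There the S-span of `B` in `L` is
free, and a basis e of it is a basis of `L/K` in which each b in `B` acts by a matrix M(b) over S.

It remains to see that Tr(b₀ db₁ ⋯ dbₙ) is regular over S. The derivation D : L → L ⊗ Ω_K has a
connection matrix Γ in the basis e, with M(Db) = dM(b) + ΓM(b) − M(b)Γ, and nothing makes Γ regular
over S. To get rid of Γ, adjoin auxiliary odd vectors ξᵢ and pack the form into y = ∑ ξᵢ Dbᵢ, whose
n-th power is ± n! ξ₁⋯ξₙ Db₁⋯Dbₙ. With X = M(∑ bᵢ ξᵢ), the identity above becomes ∑ ξᵢ dM(bᵢ) = M(y)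
+ ΓX + XΓ. Since X² = 0 and X commutes with M(y) and M(b₀), replacing M(y) by this sum changes
tr(M(b₀) M(y)ⁿ) only by traces of anticommutators of odd matrices, which vanish. Hence n! ξ₁⋯ξₙ
Tr(b₀ Db₁⋯Dbₙ) = ± tr(M(b₀) (∑ ξᵢ dM(bᵢ))ⁿ), whose right side is defined over S
(`traceTensor_mem_range_pullback`). Dividing by n! and contracting away the ξᵢ finishes the proof.
-/

/-- If `X ^ 2 = 0` and `X` commutes with `U` and `Y`, then replacing `Y` by
`Y + (Γ X + X Γ)` in `U * Y ^ n` does not change the value of an additive map that vanishes on the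
relevant anticommutators with `X`. -/
theorem map_mul_add_anticommutator_pow {W : Type*} [AddCommGroup W] (τ : E →+ W)
    {X Γ Y U : E} (hX : X * X = 0) (hY : Commute X Y) (hU : Commute X U)
    (hτ : ∀ i j : ℕ, τ (X * (U * (Y + (Γ * X + X * Γ)) ^ i * Γ * Y ^ j) +
      (U * (Y + (Γ * X + X * Γ)) ^ i * Γ * Y ^ j) * X) = 0) (n : ℕ) :
    τ (U * (Y + (Γ * X + X * Γ)) ^ n) = τ (U * Y ^ n) := by
  set P := Y + (Γ * X + X * Γ) with hP
  -- Because `X² = 0`, both products of `X` with the anticommutator equal `X Γ X`.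
  have hXP : Commute X P := by
    have h1 : X * (Γ * X + X * Γ) = X * Γ * X := by
      rw [mul_add, ← mul_assoc, ← mul_assoc, hX, zero_mul, add_zero]
    have h2 : (Γ * X + X * Γ) * X = X * Γ * X := by
      rw [add_mul, mul_assoc, hX, mul_zero, zero_add]
    exact hY.add_right (h1.trans h2.symm)
  have step : ∀ i j, τ (U * P ^ (i + 1) * Y ^ j) = τ (U * P ^ i * Y ^ (j + 1)) := by
    intro i j
    have hc : X * (U * P ^ i) = U * P ^ i * X := (hU.mul_right (hXP.pow_right i)).eq
    have hd : X * Y ^ j = Y ^ j * X := (hY.pow_right j).eq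
    -- Trading one factor `P` for a `Y` costs `U Pⁱ (ΓX + XΓ) Yʲ`; as `X` commutes with everything
    -- but `Γ`, this is the anticommutator of `X` with `U Pⁱ Γ Yʲ`.
    have e : U * P ^ (i + 1) * Y ^ j = U * P ^ i * Y ^ (j + 1) +
        (X * (U * P ^ i * Γ * Y ^ j) + (U * P ^ i * Γ * Y ^ j) * X) := by
      have e1 : X * (U * P ^ i * Γ * Y ^ j) = U * P ^ i * (X * Γ) * Y ^ j := by
        rw [← mul_assoc, ← mul_assoc, hc]; simp only [mul_assoc]
      have e2 : (U * P ^ i * Γ * Y ^ j) * X = U * P ^ i * (Γ * X) * Y ^ j := by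
        rw [mul_assoc _ (Y ^ j), ← hd]; simp only [mul_assoc]
      rw [e1, e2, pow_succ, pow_succ' Y j]
      nth_rewrite 2 [hP]
      noncomm_ring
    rw [e, map_add, hτ, add_zero]
  have : ∀ i j, τ (U * P ^ i * Y ^ j) = τ (U * Y ^ (i + j)) := by
    intro i
    induction i with
    | zero => intro j; simp
    | succ i ih => intro j; rw [step, ih, add_assoc, add_comm 1 j]
  simpa using this n 0

/-- The binomial expansion stops after the term linear in `a`. -/
theorem Commute.add_pow_succ_of_mul_self_eq_zero {a s : E} (h : Commute a s) (ha : a * a = 0)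
    (m : ℕ) : (a + s) ^ (m + 1) = s ^ (m + 1) + (m + 1) • (a * s ^ m) := by
  induction m with
  | zero => simp [add_comm]
  | succ m ih =>
    have e : a * (a * s ^ m) = 0 := by rw [← mul_assoc, ha, zero_mul]
    have e2 : s * (a * s ^ m) = a * s ^ (m + 1) := by
      rw [← mul_assoc, ← h.eq, mul_assoc, ← pow_succ']
    rw [pow_succ', ih, add_mul, mul_add, mul_add, mul_smul_comm, mul_smul_comm, e, e2, smul_zero,
      ← pow_succ', add_zero, succ_nsmul' _ (m + 1)]
    abel

/-- The power of a sum of commuting elements of square zero. -/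
theorem List.sum_pow_length_of_mul_self_eq_zero (l : List E)
    (hc : l.Pairwise Commute) (h0 : ∀ a ∈ l, a * a = 0) :
    l.sum ^ l.length = l.length.factorial • l.prod ∧ l.sum ^ (l.length + 1) = 0 := by
  induction l with
  | nil => simp
  | cons a l ih =>
    rw [List.pairwise_cons] at hc
    obtain ⟨ih1, ih2⟩ := ih hc.2 fun b hb => h0 b (List.mem_cons_of_mem _ hb)
    have hcs : Commute a l.sum := Commute.list_sum_right _ _ hc.1
    have ha := h0 a List.mem_cons_self
    simp only [List.sum_cons, List.length_cons, List.prod_cons]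
    -- The vanishing of the next power of the tail, carried as the second conjunct, leaves only the
    -- term linear in `a`.
    rw [hcs.add_pow_succ_of_mul_self_eq_zero ha, hcs.add_pow_succ_of_mul_self_eq_zero ha, ih2, ih1,
      pow_succ' l.sum (l.length + 1), ih2, mul_zero, mul_zero, smul_zero, zero_add, zero_add,
      mul_smul_comm, smul_smul, Nat.factorial_succ]
    exact ⟨rfl, rfl⟩

theorem mul_list_prod_eq_neg_one_pow {y : E} (l : List E)
    (h : ∀ a ∈ l, y * a = -(a * y)) : y * l.prod = (-1) ^ l.length * (l.prod * y) := by
  induction l with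
  | nil => simp
  | cons a l ih =>
    have h2 := ih fun b hb => h b (List.mem_cons_of_mem _ hb)
    rw [List.prod_cons, ← mul_assoc, h a List.mem_cons_self, neg_mul, mul_assoc, h2,
      List.length_cons, pow_succ, ← mul_assoc, ((Commute.neg_one_right a).pow_right l.length).eq]
    noncomm_ring

/-- Regrouping a product of products `x i * y i` when the `y i` anticommute with the `x j`. -/
theorem prod_map_mul_eq_units_mul {ι : Type*} (x y : ι → E) (l : List ι)
    (h : ∀ i j, y i * x j = -(x j * y i)) :
    ∃ m : ℕ, (l.map fun i => x i * y i).prod = (-1) ^ m * ((l.map x).prod * (l.map y).prod) := by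
  induction l with
  | nil => exact ⟨0, by simp⟩
  | cons i l ih =>
    obtain ⟨m, hm⟩ := ih
    have h1 := mul_list_prod_eq_neg_one_pow (y := y i) (l.map x) (by
      intro a ha
      obtain ⟨j, -, rfl⟩ := List.mem_map.1 ha
      exact h i j)
    refine ⟨(l.map x).length + m, ?_⟩
    simp only [List.map_cons, List.prod_cons]
    have c1 : Commute (x i * y i) ((-1 : E) ^ m) := (Commute.neg_one_right _).pow_right m
    have c2 : Commute (x i) ((-1 : E) ^ (l.map x).length) := (Commute.neg_one_right _).pow_right _
    rw [hm, ← mul_assoc, c1.eq, mul_assoc, mul_assoc (x i), ← mul_assoc (y i), h1, pow_add,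
      ← mul_assoc (x i), ← mul_assoc (x i), c2.eq, (Commute.pow_pow_self (-1 : E) _ m).eq]
    simp only [mul_assoc]

end NoncommRing

/-! ### Parity in the exterior algebra and traces of odd matrices. -/

section SuperTrace

variable (K V : Type*) [CommRing K] [AddCommGroup V] [Module K V]

/-- The elements of the exterior algebra that commute with all vectors. -/
def ExteriorAlgebra.commVectors : Subalgebra K (ExteriorAlgebra K V) :=
  Subalgebra.centralizer K (Set.range (ExteriorAlgebra.ι K))

/-- The elements of the exterior algebra that anticommute with all vectors. -/
def ExteriorAlgebra.antiVectors : Submodule K (ExteriorAlgebra K V) where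
  carrier := {w | ∀ v, w * ExteriorAlgebra.ι K v = -(ExteriorAlgebra.ι K v * w)}
  add_mem' ha hb v := by rw [add_mul, mul_add, ha, hb, neg_add]
  zero_mem' v := by simp
  smul_mem' c x hx v := by rw [smul_mul_assoc, hx, mul_smul_comm, smul_neg]

variable {K V}

open ExteriorAlgebra

theorem mem_commVectors {w : ExteriorAlgebra K V} :
    w ∈ commVectors K V ↔ ∀ v, w * ι K v = ι K v * w := by
  simp only [commVectors, Subalgebra.mem_centralizer_iff, Set.forall_mem_range, eq_comm]

theorem ι_mem_antiVectors (v : V) : ι K v ∈ antiVectors K V := fun u =>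
  eq_neg_of_add_eq_zero_left (ι_add_mul_swap v u)

theorem mul_mem_antiVectors_left {a b : ExteriorAlgebra K V} (ha : a ∈ commVectors K V)
    (hb : b ∈ antiVectors K V) : a * b ∈ antiVectors K V := fun v => by
  rw [mul_assoc, hb, mul_neg, ← mul_assoc, mem_commVectors.1 ha, mul_assoc]

theorem mul_mem_antiVectors_right {a b : ExteriorAlgebra K V} (ha : a ∈ antiVectors K V)
    (hb : b ∈ commVectors K V) : a * b ∈ antiVectors K V := fun v => by
  rw [mul_assoc, mem_commVectors.1 hb, ← mul_assoc, ha, neg_mul, mul_assoc]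

theorem mul_mem_commVectors_of_antiVectors {a b : ExteriorAlgebra K V} (ha : a ∈ antiVectors K V)
    (hb : b ∈ antiVectors K V) : a * b ∈ commVectors K V := mem_commVectors.2 fun v => by
  rw [mul_assoc, hb, mul_neg, ← mul_assoc, ha, neg_mul, neg_neg, mul_assoc]

variable {m : Type*} [Fintype m]

theorem matrix_mul_mem_antiVectors_left {M N : Matrix m m (ExteriorAlgebra K V)}
    (hM : ∀ i j, M i j ∈ commVectors K V) (hN : ∀ i j, N i j ∈ antiVectors K V) (i j : m) :
    (M * N) i j ∈ antiVectors K V := by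
  rw [Matrix.mul_apply]
  exact Submodule.sum_mem _ fun l _ => mul_mem_antiVectors_left (hM _ _) (hN _ _)

theorem matrix_mul_mem_antiVectors_right {M N : Matrix m m (ExteriorAlgebra K V)}
    (hM : ∀ i j, M i j ∈ antiVectors K V) (hN : ∀ i j, N i j ∈ commVectors K V) (i j : m) :
    (M * N) i j ∈ antiVectors K V := by
  rw [Matrix.mul_apply]
  exact Submodule.sum_mem _ fun l _ => mul_mem_antiVectors_right (hM _ _) (hN _ _)

theorem matrix_mul_mem_commVectors {M N : Matrix m m (ExteriorAlgebra K V)}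
    (hM : ∀ i j, M i j ∈ commVectors K V) (hN : ∀ i j, N i j ∈ commVectors K V) (i j : m) :
    (M * N) i j ∈ commVectors K V := by
  rw [Matrix.mul_apply]
  exact Subalgebra.sum_mem _ fun l _ => Subalgebra.mul_mem _ (hM _ _) (hN _ _)

theorem matrix_mul_mem_commVectors_of_antiVectors {M N : Matrix m m (ExteriorAlgebra K V)}
    (hM : ∀ i j, M i j ∈ antiVectors K V) (hN : ∀ i j, N i j ∈ antiVectors K V) (i j : m) :
    (M * N) i j ∈ commVectors K V := by
  rw [Matrix.mul_apply]
  exact Subalgebra.sum_mem _ fun l _ => mul_mem_commVectors_of_antiVectors (hM _ _) (hN _ _)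

theorem matrix_pow_mem_commVectors [DecidableEq m] {M : Matrix m m (ExteriorAlgebra K V)}
    (hM : ∀ i j, M i j ∈ commVectors K V) (n : ℕ) : ∀ i j, (M ^ n) i j ∈ commVectors K V := by
  induction n with
  | zero =>
    intro i j
    rw [pow_zero, Matrix.one_apply]
    split_ifs
    exacts [Subalgebra.one_mem _, Subalgebra.zero_mem _]
  | succ n ih => rw [pow_succ]; exact matrix_mul_mem_commVectors ih hM

/-- The trace of the anticommutator of two odd matrices vanishes. -/
theorem trace_anticommutator {X U : Matrix m m (ExteriorAlgebra K V)}
    (hX : ∀ i j, X i j ∈ LinearMap.range (ι K (M := V)))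
    (hU : ∀ i j, U i j ∈ antiVectors K V) : (X * U + U * X).trace = 0 := by
  simp only [Matrix.trace, Matrix.diag, Matrix.add_apply, Matrix.mul_apply, Finset.sum_add_distrib]
  -- Exchanging the sums in the first trace pairs `X j i * U i j` with `U i j * X j i`, which cancel
  -- by parity.
  rw [Finset.sum_comm, ← Finset.sum_add_distrib]
  refine Finset.sum_eq_zero fun i _ => ?_
  rw [← Finset.sum_add_distrib]
  refine Finset.sum_eq_zero fun j _ => ?_
  obtain ⟨v, hv⟩ := hX j i
  rw [← hv, hU, add_neg_cancel]

/-- Replacing the even matrix `Y` by `Y + (Γ X + X Γ)` does not change the trace of `U * Y ^ n`,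
when `X` and `Γ` are odd, `X ^ 2 = 0`, and `X` commutes with `U` and `Y`. -/
theorem trace_mul_add_anticommutator_pow [DecidableEq m]
    {X Γ Y U : Matrix m m (ExteriorAlgebra K V)} (hX2 : X * X = 0) (hXY : Commute X Y)
    (hXU : Commute X U) (hX : ∀ i j, X i j ∈ LinearMap.range (ι K (M := V)))
    (hΓ : ∀ i j, Γ i j ∈ antiVectors K V) (hY : ∀ i j, Y i j ∈ commVectors K V)
    (hU : ∀ i j, U i j ∈ commVectors K V) (n : ℕ) :
    (U * (Y + (Γ * X + X * Γ)) ^ n).trace = (U * Y ^ n).trace := by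
  have hX' : ∀ i j, X i j ∈ antiVectors K V := fun i j => by
    obtain ⟨v, hv⟩ := hX i j
    exact hv ▸ ι_mem_antiVectors v
  have hP : ∀ i j, (Y + (Γ * X + X * Γ)) i j ∈ commVectors K V := fun i j =>
    Subalgebra.add_mem _ (hY i j) (Subalgebra.add_mem _
      (matrix_mul_mem_commVectors_of_antiVectors hΓ hX' i j)
      (matrix_mul_mem_commVectors_of_antiVectors hX' hΓ i j))
  refine map_mul_add_anticommutator_pow (Matrix.traceAddMonoidHom m (ExteriorAlgebra K V))
    hX2 hXY hXU (fun a b => ?_) n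
  exact trace_anticommutator hX (matrix_mul_mem_antiVectors_right (matrix_mul_mem_antiVectors_left
    (matrix_mul_mem_commVectors hU (matrix_pow_mem_commVectors hP a)) hΓ)
    (matrix_pow_mem_commVectors hY b))

end SuperTrace

/-! ### Multiplication matrices and the trace after base change. -/

section TensorMatrix

variable {K L W m : Type*} [CommRing K] [CommRing L] [Algebra K L] [Ring W] [Algebra K W]
  [Fintype m] [DecidableEq m] (e : Module.Basis m K L)

theorem commute_mapMatrix_leftMulMatrix_scalar (l : L) (w : W) :
    Commute (((Algebra.ofId K W).mapMatrix.comp (Algebra.leftMulMatrix e)) l)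
      (Matrix.scalarAlgHom m K w) := by
  refine Matrix.ext fun i j => ?_
  simp [Algebra.ofId_apply, Algebra.commutes]

/-- Left multiplication on `L ⊗[K] W`, as matrices over `W`, for a `K`-basis of `L`. -/
def mulMatrixTensor : L ⊗[K] W →ₐ[K] Matrix m m W :=
  Algebra.TensorProduct.lift ((Algebra.ofId K W).mapMatrix.comp (Algebra.leftMulMatrix e))
    (Matrix.scalarAlgHom m K) (commute_mapMatrix_leftMulMatrix_scalar e)

theorem mulMatrixTensor_tmul (l : L) (w : W) (i j : m) :
    mulMatrixTensor e (l ⊗ₜ[K] w) i j = Algebra.leftMulMatrix e l i j • w := by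
  rw [mulMatrixTensor, Algebra.TensorProduct.lift_tmul]
  simp [Algebra.ofId_apply, Algebra.smul_def]

/-- The coordinates on `L ⊗[K] W` with values in `W` for a `K`-basis of `L`. -/
def coordTensor (i : m) : L ⊗[K] W →ₗ[K] W :=
  (TensorProduct.lid K W).toLinearMap ∘ₗ (e.coord i).rTensor W

@[simp] theorem coordTensor_tmul (i : m) (l : L) (w : W) :
    coordTensor e i (l ⊗ₜ[K] w) = e.repr l i • w := by
  simp [coordTensor]

theorem mulMatrixTensor_eq_coordTensor (x : L ⊗[K] W) (i j : m) :
    mulMatrixTensor e x i j = coordTensor e i (x * (e j ⊗ₜ[K] 1)) := by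
  induction x with
  | zero => simp
  | tmul l w => simp [mulMatrixTensor_tmul, Algebra.leftMulMatrix_eq_repr_mul]
  | add x y hx hy => simp [hx, hy, add_mul]

theorem coordTensor_tmul_one_mul (b : L) (x : L ⊗[K] W) (i : m) :
    coordTensor e i ((b ⊗ₜ[K] 1) * x) =
      ∑ j, Algebra.leftMulMatrix e b i j • coordTensor e j x := by
  induction x with
  | zero => simp
  | tmul l w =>
    have : e.repr (b * l) i = ∑ j, Algebra.leftMulMatrix e b i j * e.repr l j := by
      rw [← Algebra.leftMulMatrix_mulVec_repr]; rfl
    simp [this, Finset.sum_smul, mul_smul]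
  | add x y hx hy => simp [hx, hy, mul_add, Finset.sum_add_distrib]

variable (K L W) in
/-- The base change to `W` of the trace of `L` over `K`. -/
def traceTensor : L ⊗[K] W →ₗ[K] W :=
  (TensorProduct.lid K W).toLinearMap ∘ₗ (Algebra.trace K L).rTensor W

@[simp] theorem traceTensor_tmul (l : L) (w : W) :
    traceTensor K L W (l ⊗ₜ[K] w) = Algebra.trace K L l • w := by
  simp [traceTensor]

theorem trace_mulMatrixTensor (x : L ⊗[K] W) :
    (mulMatrixTensor e x).trace = traceTensor K L W x := by
  induction x with
  | zero => simp
  | tmul l w =>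
    rw [traceTensor_tmul, Algebra.trace_eq_matrix_trace e]
    simp [Matrix.trace, mulMatrixTensor_tmul, Finset.sum_smul]
  | add x y hx hy => simp [hx, hy, Matrix.trace_add]

end TensorMatrix

/-! ### The connection matrix of a derivation in a basis. -/

section Connection

open ExteriorAlgebra

variable {K L V m : Type*} [CommRing K] [CommRing L] [Algebra K L] [AddCommGroup V] [Module K V]
  [Fintype m] [DecidableEq m] (e : Module.Basis m K L)
  (D : L →+ L ⊗[K] V) (d : K → V)

variable (K L V) in
/-- The inclusion of `L ⊗ V` in `L ⊗ ⋀ V`. -/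
def tensorι : L ⊗[K] V →ₗ[L] L ⊗[K] ExteriorAlgebra K V := (ι K).baseChange L

@[simp] theorem tensorι_tmul (l : L) (v : V) :
    tensorι K L V (l ⊗ₜ[K] v) = l ⊗ₜ[K] ι K v := rfl

theorem tensorι_smul (l : L) (x : L ⊗[K] V) :
    tensorι K L V (l • x) = (l ⊗ₜ[K] 1) * tensorι K L V x := by
  rw [map_smul, Algebra.smul_def, Algebra.TensorProduct.algebraMap_apply, Algebra.algebraMap_self,
    RingHom.id_apply]

theorem coordTensor_tensorι_mem (x : L ⊗[K] V) (i : m) :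
    coordTensor e i (tensorι K L V x) ∈ LinearMap.range (ι K (M := V)) := by
  induction x with
  | zero => simp
  | tmul l v => exact ⟨e.repr l i • v, by simp⟩
  | add x y hx hy => rw [map_add, map_add]; exact Submodule.add_mem _ hx hy

/-- The matrix of a connection in a basis. -/
def connectionMatrix : Matrix m m (ExteriorAlgebra K V) :=
  fun i j => coordTensor e i (tensorι K L V (D (e j)))

/-- The matrix of the differentials of the entries of a multiplication matrix. -/
def diffMatrix (b : L) : Matrix m m (ExteriorAlgebra K V) :=
  fun i j => ι K (d (Algebra.leftMulMatrix e b i j))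

/-- The differential of a multiplication matrix in terms of the connection matrix. -/
theorem mulMatrixTensor_tensorι (hD : ∀ x y, D (x * y) = x • D y + y • D x)
    (hd : ∀ x : K, D (algebraMap K L x) = 1 ⊗ₜ[K] d x) (b : L) :
    mulMatrixTensor e (tensorι K L V (D b)) + mulMatrixTensor e (b ⊗ₜ[K] 1) * connectionMatrix e D
      = diffMatrix e d b + connectionMatrix e D * mulMatrixTensor e (b ⊗ₜ[K] 1) := by
  refine Matrix.ext fun i j => ?_
  -- Both sides are the coordinates of `D (b * e j)`: here by Leibniz on the product, below after
  -- expanding `b * e j` in the basis.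
  have h1 : coordTensor e i (tensorι K L V (D (b * e j))) =
      (mulMatrixTensor e (tensorι K L V (D b)) + mulMatrixTensor e (b ⊗ₜ[K] 1) *
        connectionMatrix e D : Matrix m m (ExteriorAlgebra K V)) i j := by
    rw [hD, map_add, map_add, tensorι_smul, tensorι_smul, coordTensor_tmul_one_mul,
      Matrix.add_apply, Matrix.mul_apply, mulMatrixTensor_eq_coordTensor, add_comm]
    congr 1
    · congr 1
      refine Commute.eq ?_
      induction D b with
      | zero => simp
      | tmul l v => simp [Commute, SemiconjBy, mul_comm]
      | add x y hx hy => rw [map_add]; exact hx.add_right hy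
    · refine Finset.sum_congr rfl fun l _ => ?_
      rw [mulMatrixTensor_tmul, smul_mul_assoc, one_mul]; rfl
  have h2 : b * e j = ∑ l, algebraMap K L (Algebra.leftMulMatrix e b l j) * e l := by
    rw [← e.sum_repr (b * e j)]
    simp [Algebra.leftMulMatrix_eq_repr_mul, Algebra.smul_def]
  rw [← h1, h2, map_sum, map_sum, map_sum]
  simp only [hD, hd, map_add, algebraMap_smul]
  rw [Finset.sum_add_distrib, Matrix.add_apply, Matrix.mul_apply, add_comm]
  congr 1
  · rw [Finset.sum_eq_single i]
    · rw [tensorι_smul, tensorι_tmul]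
      simp [diffMatrix]
    · intro l _ hl
      rw [tensorι_smul, tensorι_tmul]
      simp [hl]
    · simp
  · refine Finset.sum_congr rfl fun l _ => ?_
    rw [LinearMap.map_smul_of_tower, map_smul, mulMatrixTensor_tmul, mul_smul_comm, mul_one]
    rfl

end Connection

/-! ### The trace formula with auxiliary odd vectors. -/

section TraceFormula

open ExteriorAlgebra

variable {K L V m : Type*} [CommRing K] [CommRing L] [Algebra K L] [AddCommGroup V] [Module K V]

theorem tensorι_mul_tensorι (x y : L ⊗[K] V) :
    tensorι K L V x * tensorι K L V y = -(tensorι K L V y * tensorι K L V x) := by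
  induction x with
  | zero => simp
  | tmul l v =>
    induction y with
    | zero => simp
    | tmul l' v' =>
      simp [mul_comm l l', ← TensorProduct.tmul_neg, eq_neg_of_add_eq_zero_left (ι_add_mul_swap v v')]
    | add x y hx hy => rw [map_add, mul_add, add_mul, hx, hy, neg_add]
  | add x y hx hy => rw [map_add, mul_add, add_mul, hx, hy, neg_add]

/-- Anticommutation alone would not suffice, as 2 need not be invertible; it only cancels the cross
terms in the additive step. -/
theorem tensorι_mul_self (x : L ⊗[K] V) : tensorι K L V x * tensorι K L V x = 0 := by
  induction x with
  | zero => simp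
  | tmul l v => simp
  | add x y hx hy =>
    rw [map_add, mul_add, add_mul, add_mul, hx, hy, tensorι_mul_tensorι x y]
    abel

theorem commute_tensorι_mul_tensorι (x y z : L ⊗[K] V) :
    Commute (tensorι K L V x) (tensorι K L V y * tensorι K L V z) := by
  rw [Commute, SemiconjBy, ← mul_assoc, tensorι_mul_tensorι x y, neg_mul, mul_assoc,
    tensorι_mul_tensorι x z, mul_neg, neg_neg, mul_assoc]

/-- This is the source of `map_wedge`, and it also lets the auxiliary vectors be pulled out of the
trace. -/
theorem traceTensor_one_tmul_mul {W : Type*} [Ring W] [Algebra K W] (w : W) (x : L ⊗[K] W) :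
    traceTensor K L W ((1 ⊗ₜ[K] w) * x) = w * traceTensor K L W x := by
  induction x with
  | zero => simp
  | tmul l w' => simp
  | add x y hx hy => simp [mul_add, hx, hy]

variable [Fintype m] [DecidableEq m] (e : Module.Basis m K L)
  (D : L →+ L ⊗[K] V) (d : K → V)

theorem mulMatrixTensor_tensorι_mem (x : L ⊗[K] V) (i j : m) :
    mulMatrixTensor e (tensorι K L V x) i j ∈ LinearMap.range (ι K (M := V)) := by
  have : tensorι K L V x * (e j ⊗ₜ[K] 1) = tensorι K L V (e j • x) := by
    rw [tensorι_smul]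
    induction x with
    | zero => simp
    | tmul l v => simp [mul_comm]
    | add x y hx hy => rw [map_add, mul_add, add_mul, hx, hy]
  rw [mulMatrixTensor_eq_coordTensor, this]
  exact coordTensor_tensorι_mem _ _ _

theorem mulMatrixTensor_tensorι_mem_antiVectors (x : L ⊗[K] V) (i j : m) :
    mulMatrixTensor e (tensorι K L V x) i j ∈ antiVectors K V := by
  obtain ⟨v, hv⟩ := mulMatrixTensor_tensorι_mem e x i j
  exact hv ▸ ι_mem_antiVectors v

theorem mulMatrixTensor_one_tmul {W : Type*} [Ring W] [Algebra K W] (w : W) :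
    mulMatrixTensor e (1 ⊗ₜ[K] w) = Matrix.scalar m w := by
  refine Matrix.ext fun i j => ?_
  rw [mulMatrixTensor_tmul, map_one, Matrix.one_apply, Matrix.scalar_apply, Matrix.diagonal_apply]
  split_ifs <;> simp

/-- The entries of the connection matrix are vectors. The resulting sign turns the commutator of `Γ`
with a multiplication matrix into an anticommutator. -/
theorem scalar_mul_connectionMatrix (v : V) :
    Matrix.scalar m (ι K v) * connectionMatrix e D =
      -(connectionMatrix e D * Matrix.scalar m (ι K v)) := by
  refine Matrix.ext fun i j => ?_
  rw [Matrix.neg_apply, Matrix.scalar_apply, Matrix.diagonal_mul, Matrix.mul_diagonal]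
  obtain ⟨u, hu⟩ := coordTensor_tensorι_mem e (D (e j)) i
  change _ * coordTensor _ _ _ = -(coordTensor _ _ _ * _)
  rw [← hu]
  exact ι_mem_antiVectors v u

/-- A trace on `L ⊗ ⋀ V` in terms of the differentials of the entries of multiplication
matrices. -/
theorem traceTensor_mul_sum_pow (hD : ∀ x y, D (x * y) = x • D y + y • D x)
    (hd : ∀ x : K, D (algebraMap K L x) = 1 ⊗ₜ[K] d x) {σ : Type*} [Fintype σ]
    (b₀ : L) (b : σ → L) (ξ : σ → V) (n : ℕ) :
    traceTensor K L (ExteriorAlgebra K V)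
        ((b₀ ⊗ₜ[K] 1) * (∑ i, (1 ⊗ₜ[K] ι K (ξ i)) * tensorι K L V (D (b i))) ^ n) =
      (mulMatrixTensor e (b₀ ⊗ₜ[K] 1) *
        (∑ i, Matrix.scalar m (ι K (ξ i)) * diffMatrix e d (b i)) ^ n).trace := by
  set Γ := connectionMatrix e D with hΓ
  -- A single odd element collecting all the `b i`: its matrix `X` absorbs every connection term at
  -- once.
  set z : L ⊗[K] V := ∑ i, b i ⊗ₜ[K] ξ i with hz
  set X : Matrix m m (ExteriorAlgebra K V) := mulMatrixTensor e (tensorι K L V z) with hX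
  set y := ∑ i, (1 ⊗ₜ[K] ι K (ξ i)) * tensorι K L V (D (b i)) with hy
  have hP : ∑ i, Matrix.scalar m (ι K (ξ i)) * diffMatrix e d (b i) =
      mulMatrixTensor e y + (Γ * X + X * Γ) := by
    rw [hy, hX, hz, map_sum, map_sum, map_sum, Finset.mul_sum, Finset.sum_mul,
      ← Finset.sum_add_distrib, ← Finset.sum_add_distrib]
    refine Finset.sum_congr rfl fun i _ => ?_
    have h1 : diffMatrix e d (b i) = mulMatrixTensor e (tensorι K L V (D (b i))) +
        mulMatrixTensor e (b i ⊗ₜ[K] 1) * Γ - Γ * mulMatrixTensor e (b i ⊗ₜ[K] 1) := by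
      rw [hΓ, mulMatrixTensor_tensorι e D d hD hd]; abel
    have h2 : Matrix.scalar m (ι K (ξ i)) * mulMatrixTensor e (b i ⊗ₜ[K] 1) =
        mulMatrixTensor e (b i ⊗ₜ[K] ι K (ξ i)) := by
      rw [← mulMatrixTensor_one_tmul e, ← map_mul]; simp
    rw [h1, map_mul, mulMatrixTensor_one_tmul, tensorι_tmul, mul_sub, mul_add, ← mul_assoc, h2,
      ← mul_assoc, hΓ, scalar_mul_connectionMatrix, neg_mul, mul_assoc _ (Matrix.scalar m _), h2]
    abel
  have hcomm : Commute (tensorι K L V z) y :=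
    Commute.sum_right _ _ _ fun i _ => by
      rw [← tensorι_tmul]; exact commute_tensorι_mul_tensorι _ _ _
  have hcomm0 : Commute (tensorι K L V z) (b₀ ⊗ₜ[K] 1) := by
    induction z with
    | zero => simp
    | tmul l v => simp [Commute, SemiconjBy, mul_comm]
    | add x y hx hy => rw [map_add]; exact hx.add_left hy
  rw [hP, ← trace_mulMatrixTensor e, map_mul, map_pow]
  refine (trace_mul_add_anticommutator_pow ?_ (hcomm.map _) (hcomm0.map _)
    (mulMatrixTensor_tensorι_mem e z) ?_ ?_ ?_ n).symm
  · rw [← map_mul, tensorι_mul_self, map_zero]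
  · intro i j
    obtain ⟨v, hv⟩ := coordTensor_tensorι_mem e (D (e j)) i
    change coordTensor _ _ _ ∈ _
    exact hv ▸ ι_mem_antiVectors v
  · intro i j
    rw [hy, map_sum, Matrix.sum_apply]
    refine Subalgebra.sum_mem _ fun l _ => ?_
    rw [map_mul, ← tensorι_tmul]
    exact matrix_mul_mem_commVectors_of_antiVectors
      (mulMatrixTensor_tensorι_mem_antiVectors e _) (mulMatrixTensor_tensorι_mem_antiVectors e _) i j
  · intro i j
    rw [mulMatrixTensor_tmul]
    exact Subalgebra.smul_mem _ (Subalgebra.one_mem _) _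

/-- Up to a factorial and a sign, the trace of `b₀ D b₁ ⋯ D bₙ` multiplied by auxiliary vectors
`ξ₁ ⋯ ξₙ`, in terms of the differentials of the entries of multiplication matrices. -/
theorem factorial_smul_prod_mul_traceTensor (hD : ∀ x y, D (x * y) = x • D y + y • D x)
    (hd : ∀ x : K, D (algebraMap K L x) = 1 ⊗ₜ[K] d x) {n : ℕ}
    (b₀ : L) (b : Fin n → L) (ξ : Fin n → V) :
    ∃ u : ℕ, (mulMatrixTensor e (b₀ ⊗ₜ[K] 1) *
        (∑ i, Matrix.scalar m (ι K (ξ i)) * diffMatrix e d (b i)) ^ n).trace =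
      n.factorial • ((-1) ^ u * (((List.finRange n).map fun i => ι K (ξ i)).prod *
        traceTensor K L (ExteriorAlgebra K V) ((b₀ ⊗ₜ[K] 1) *
          ((List.finRange n).map fun i => tensorι K L V (D (b i))).prod))) := by
  -- The sign from moving all `ξ i` to the left is left implicit: being a unit, it does not affect
  -- regularity.
  obtain ⟨u, hu⟩ := prod_map_mul_eq_units_mul
    (fun i => (1 : L) ⊗ₜ[K] ι K (ξ i)) (fun i => tensorι K L V (D (b i))) (List.finRange n)
    (fun i j => by rw [← tensorι_tmul]; exact tensorι_mul_tensorι _ _)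
  refine ⟨u, ?_⟩
  have h1 := (List.sum_pow_length_of_mul_self_eq_zero ((List.finRange n).map fun i =>
    ((1 : L) ⊗ₜ[K] ι K (ξ i)) * tensorι K L V (D (b i)))
    (List.pairwise_map.2 (List.Pairwise.imp (R := fun _ _ => True) (fun {i j} _ => by
      rw [← tensorι_tmul, ← tensorι_tmul]
      exact (commute_tensorι_mul_tensorι _ _ _).mul_left (commute_tensorι_mul_tensorι _ _ _))
      (List.pairwise_of_forall (by simp)))) (by
      intro a ha
      obtain ⟨i, -, rfl⟩ := List.mem_map.1 ha
      rw [← tensorι_tmul, mul_assoc, ← mul_assoc (tensorι K L V (D (b i))),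
        tensorι_mul_tensorι (D (b i)), neg_mul, mul_assoc, tensorι_mul_self]
      simp)).1
  rw [List.length_map, List.length_finRange] at h1
  rw [← traceTensor_mul_sum_pow e D d hD hd, Fin.sum_univ_def, h1, hu, mul_smul_comm, map_nsmul]
  congr 1
  have h2 : (((List.finRange n).map fun i => (1 : L) ⊗ₜ[K] ι K (ξ i)).prod :
      L ⊗[K] ExteriorAlgebra K V) = 1 ⊗ₜ[K] ((List.finRange n).map fun i => ι K (ξ i)).prod := by
    have := map_list_prod (Algebra.TensorProduct.includeRight :
      ExteriorAlgebra K V →ₐ[K] L ⊗[K] ExteriorAlgebra K V)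
      ((List.finRange n).map fun i => ι K (ξ i))
    rw [List.map_map] at this
    exact this.symm
  have h3 : ((-1 : L ⊗[K] ExteriorAlgebra K V) ^ u) =
      1 ⊗ₜ[K] ((-1 : ExteriorAlgebra K V) ^ u) := by
    have := map_pow (Algebra.TensorProduct.includeRight :
      ExteriorAlgebra K V →ₐ[K] L ⊗[K] ExteriorAlgebra K V) (-1) u
    rw [map_neg, map_one] at this
    exact this.symm
  have h4 : ∀ (w : ExteriorAlgebra K V) (x : L ⊗[K] ExteriorAlgebra K V),
      (b₀ ⊗ₜ[K] 1) * ((1 ⊗ₜ[K] w) * x) = (1 ⊗ₜ[K] w) * ((b₀ ⊗ₜ[K] 1) * x) := fun w x => by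
    rw [← mul_assoc, ← mul_assoc]; simp
  rw [h2, h3, h4, h4, traceTensor_one_tmul_mul, traceTensor_one_tmul_mul]

end TraceFormula

/-! ### Contractions, and exterior algebras over a ring extension. -/

section SemilinearExterior

open ExteriorAlgebra

variable {S K M N : Type*} [CommRing S] [CommRing K] [Algebra S K] [AddCommGroup M] [Module S M]
  [AddCommGroup N] [Module S N] [Module K N] [IsScalarTower S K N]

/-- The morphism of exterior algebras over `S → K` induced by an `S`-linear map. -/
def ExteriorAlgebra.mapTower (K : Type*) [CommRing K] [Algebra S K] [Module K N]
    [IsScalarTower S K N] (f : M →ₗ[S] N) : ExteriorAlgebra S M →ₐ[S] ExteriorAlgebra K N :=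
  ExteriorAlgebra.lift S ⟨(ExteriorAlgebra.ι K).restrictScalars S ∘ₗ f,
    fun m => ExteriorAlgebra.ι_sq_zero (f m)⟩

@[simp] theorem ExteriorAlgebra.mapTower_ι (f : M →ₗ[S] N) (x : M) :
    mapTower K f (ι S x) = ι K (f x) := by
  exact lift_ι_apply ..

/-- A functional defined over `S` contracts regular elements to regular elements; this is what
permits removing the auxiliary vectors without leaving the image of `mapTower`. -/
theorem contractLeft_mapTower (f : M →ₗ[S] N) (φ : Module.Dual S M) (ψ : Module.Dual K N)
    (h : ∀ x, ψ (f x) = algebraMap S K (φ x)) (x : ExteriorAlgebra S M) :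
    CliffordAlgebra.contractLeft ψ (mapTower K f x) =
      mapTower K f (CliffordAlgebra.contractLeft φ x) := by
  induction x using CliffordAlgebra.left_induction with
  | algebraMap r =>
    rw [CliffordAlgebra.contractLeft_algebraMap, map_zero, AlgHom.commutes,
      IsScalarTower.algebraMap_apply S K, CliffordAlgebra.contractLeft_algebraMap]
  | add x y hx hy => simp only [map_add, hx, hy]
  | ι_mul x m hx =>
    have h1 : mapTower K f (CliffordAlgebra.ι 0 m) = CliffordAlgebra.ι 0 (f m) :=
      mapTower_ι f m
    rw [map_mul, h1, CliffordAlgebra.contractLeft_ι_mul, CliffordAlgebra.contractLeft_ι_mul, hx,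
      map_sub, map_mul, h1, map_smul, h, algebraMap_smul]

theorem contractLeft_map_eq_zero {N' : Type*} [AddCommGroup N'] [Module K N'] (j : N →ₗ[K] N')
    (ψ : Module.Dual K N') (h : ∀ x, ψ (j x) = 0) (w : ExteriorAlgebra K N) :
    CliffordAlgebra.contractLeft ψ (ExteriorAlgebra.map j w) = 0 := by
  induction w using CliffordAlgebra.left_induction with
  | algebraMap r => rw [AlgHom.commutes, CliffordAlgebra.contractLeft_algebraMap]
  | add x y hx hy => simp only [map_add, hx, hy, add_zero]
  | ι_mul x m hx =>
    have h1 : ExteriorAlgebra.map j (CliffordAlgebra.ι 0 m) = CliffordAlgebra.ι 0 (j m) :=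
      map_apply_ι j m
    rw [map_mul, h1, CliffordAlgebra.contractLeft_ι_mul, hx, h, mul_zero, zero_smul, sub_zero]

theorem contractLeft_prod_mul_eq_zero {σ : Type*} (ξ : σ → N) (ψ : Module.Dual K N) (l : List σ)
    (h : ∀ i ∈ l, ψ (ξ i) = 0) {w : ExteriorAlgebra K N}
    (hw : CliffordAlgebra.contractLeft ψ w = 0) :
    CliffordAlgebra.contractLeft ψ ((l.map fun i => ι K (ξ i)).prod * w) = 0 := by
  induction l with
  | nil => simpa using hw
  | cons i l ih =>
    have h1 := CliffordAlgebra.contractLeft_ι_mul (Q := 0) ψ (ξ i)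
      ((l.map fun i => ι K (ξ i)).prod * w)
    rw [ih fun i hi => h i (List.mem_cons_of_mem _ hi), h i List.mem_cons_self, mul_zero,
      zero_smul, sub_zero] at h1
    rw [List.map_cons, List.prod_cons, mul_assoc]
    exact h1

/-- A submodule stable under contractions contains `w` if it contains `ξ₁ ⋯ ξₙ w`, where the `ξ i`
have a dual system that contracts `w` to zero. -/
theorem mem_of_prod_mul_mem {σ : Type*} (ξ : σ → N) (ψ : σ → Module.Dual K N)
    (h1 : ∀ i, ψ i (ξ i) = 1) (h0 : ∀ i j, i ≠ j → ψ i (ξ j) = 0)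
    (R : Set (ExteriorAlgebra K N))
    (hR : ∀ i, ∀ x ∈ R, CliffordAlgebra.contractLeft (ψ i) x ∈ R)
    {w : ExteriorAlgebra K N} (hw : ∀ i, CliffordAlgebra.contractLeft (ψ i) w = 0)
    (l : List σ) (hl : l.Nodup) (hmem : (l.map fun i => ι K (ξ i)).prod * w ∈ R) : w ∈ R := by
  induction l with
  | nil => simpa using hmem
  | cons i l ih =>
    rw [List.nodup_cons] at hl
    refine ih hl.2 ?_
    -- Contraction is an antiderivation: `ψ i` strips the leading `ξ i` and kills all that follows
    -- it.
    have h2 := CliffordAlgebra.contractLeft_ι_mul (Q := 0) (ψ i) (ξ i)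
      ((l.map fun i => ι K (ξ i)).prod * w)
    rw [contractLeft_prod_mul_eq_zero ξ (ψ i) l
      (fun j hj => h0 i j fun hij => hl.1 (hij ▸ hj)) (hw i), h1, mul_zero, one_smul, sub_zero] at h2
    rw [← h2]
    refine hR i _ ?_
    rw [List.map_cons, List.prod_cons, mul_assoc] at hmem
    exact hmem

end SemilinearExterior

/-! ### Matrices with entries in a subalgebra. -/

section MatrixEntries

variable {S W m : Type*} [CommRing S] [Ring W] [Algebra S W] [Fintype m] [DecidableEq m]
  (R : Subalgebra S W)

theorem matrix_mul_mem_subalgebra {M N : Matrix m m W} (hM : ∀ i j, M i j ∈ R)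
    (hN : ∀ i j, N i j ∈ R) (i j : m) : (M * N) i j ∈ R := by
  rw [Matrix.mul_apply]
  exact Subalgebra.sum_mem _ fun l _ => Subalgebra.mul_mem _ (hM _ _) (hN _ _)

theorem matrix_pow_mem_subalgebra {M : Matrix m m W} (hM : ∀ i j, M i j ∈ R) (n : ℕ) :
    ∀ i j, (M ^ n) i j ∈ R := by
  induction n with
  | zero =>
    intro i j
    rw [pow_zero, Matrix.one_apply]
    split_ifs
    exacts [Subalgebra.one_mem _, Subalgebra.zero_mem _]
  | succ n ih => rw [pow_succ]; exact matrix_mul_mem_subalgebra R ih hM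

end MatrixEntries

/-! ### Regularity of the trace when multiplication matrices are regular. -/

section RegularTrace

open ExteriorAlgebra

variable (k S K L : Type*) [CommRing k] [CommRing S] [CommRing K] [CommRing L]
  [Algebra k S] [Algebra k K] [Algebra S K] [IsScalarTower k S K] [Algebra K L]

/-- The trace of a form `b₀ D b₁ ⋯ D bₙ` is regular over `S` if the multiplication matrices of the
`b i` have entries in `S`. -/
theorem traceTensor_mem_range_pullback {m : Type*} [Fintype m] [DecidableEq m]
    (e : Module.Basis m K L) (D : L →+ L ⊗[K] Ω[K⁄k])
    (hD : ∀ x y, D (x * y) = x • D y + y • D x)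
    (hd : ∀ x : K, D (algebraMap K L x) = 1 ⊗ₜ[K] KaehlerDifferential.D k K x)
    {n : ℕ} (hn : IsUnit (n.factorial : S)) (b₀ : L) (b : Fin n → L)
    (hb₀ : ∀ i j, Algebra.leftMulMatrix e b₀ i j ∈ (algebraMap S K).range)
    (hb : ∀ l i j, Algebra.leftMulMatrix e (b l) i j ∈ (algebraMap S K).range) :
    traceTensor K L (DiffForms k K) ((b₀ ⊗ₜ[K] 1) *
      ((List.finRange n).map fun i => tensorι K L (Ω[K⁄k]) (D (b i))).prod) ∈
      (DiffForms.pullback k S K).range := by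
  set w := traceTensor K L (DiffForms k K) ((b₀ ⊗ₜ[K] 1) *
      ((List.finRange n).map fun i => tensorι K L (Ω[K⁄k]) (D (b i))).prod) with hw
  -- The auxiliary vectors `ξ i` are a free summand added to the differentials, over `S` as well as
  -- over `K`; `ψ` and `φ` are the dual coordinates, and `R` consists of the regular elements.
  let j : Ω[K⁄k] →ₗ[K] Ω[K⁄k] × (Fin n → K) := LinearMap.inl K _ _
  let f : Ω[S⁄k] × (Fin n → S) →ₗ[S] Ω[K⁄k] × (Fin n → K) :=
    (KaehlerDifferential.map k k S K).prodMap
      (LinearMap.pi fun i => (Algebra.linearMap S K) ∘ₗ LinearMap.proj i)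
  let ξ : Fin n → Ω[K⁄k] × (Fin n → K) := fun i => (0, Pi.single i 1)
  let ψ : Fin n → Module.Dual K (Ω[K⁄k] × (Fin n → K)) := fun i => LinearMap.proj i ∘ₗ LinearMap.snd K _ _
  let φ : Fin n → Module.Dual S (Ω[S⁄k] × (Fin n → S)) :=
    fun i => LinearMap.proj i ∘ₗ LinearMap.snd S _ _
  let R : Subalgebra S (ExteriorAlgebra K (Ω[K⁄k] × (Fin n → K))) := (mapTower K f).range
  let D' : L →+ L ⊗[K] (Ω[K⁄k] × (Fin n → K)) := (j.lTensor L).toAddMonoidHom.comp D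
  have key : ExteriorAlgebra.map j w ∈ R := by
    obtain ⟨u, hu⟩ := factorial_smul_prod_mul_traceTensor e D'
      (fun x => j (KaehlerDifferential.D k K x))
      (fun x y => by
        change j.baseChange L _ = _ • j.baseChange L _ + _ • j.baseChange L _
        rw [hD, map_add, map_smul, map_smul])
      (fun x => by
        change j.baseChange L _ = _
        rw [hd, LinearMap.baseChange_tmul]) b₀ b ξ
    let J : L ⊗[K] DiffForms k K →ₐ[K] L ⊗[K] ExteriorAlgebra K (Ω[K⁄k] × (Fin n → K)) :=
      Algebra.TensorProduct.map (AlgHom.id K L) (ExteriorAlgebra.map j)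
    have hJ : ∀ x, tensorι K L (Ω[K⁄k] × (Fin n → K)) (j.lTensor L x) = J (tensorι K L _ x) := by
      intro x
      induction x with
      | zero => simp
      | tmul l v => simp [J]
      | add x y hx hy => simp only [map_add, hx, hy]
    have hJt : ∀ x, traceTensor K L _ (J x) = ExteriorAlgebra.map j (traceTensor K L _ x) := by
      intro x
      induction x with
      | zero => simp
      | tmul l v => simp [J]
      | add x y hx hy => simp only [map_add, hx, hy]
    have e1 : traceTensor K L (ExteriorAlgebra K (Ω[K⁄k] × (Fin n → K))) ((b₀ ⊗ₜ[K] 1) *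
          ((List.finRange n).map fun i => tensorι K L (Ω[K⁄k] × (Fin n → K)) (D' (b i))).prod) =
        ExteriorAlgebra.map j w := by
      rw [hw, ← hJt, map_mul J, map_list_prod J, List.map_map]
      congr 2
      · simp [J]
      · congr 1
        exact List.map_congr_left fun i _ => hJ _
    rw [e1] at hu
    -- The form `w` does not involve the `ξ i`, so it can be recovered from `ξ₁ ⋯ ξₙ w` by
    -- contractions that preserve `R`.
    refine mem_of_prod_mul_mem ξ ψ (by simp [ξ, ψ]) (fun i j hij => by simp [ξ, ψ, hij])
      (R : Set (ExteriorAlgebra K (Ω[K⁄k] × (Fin n → K)))) ?_ ?_ (List.finRange n) (List.nodup_finRange n) ?_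
    · rintro i _ ⟨y, rfl⟩
      exact ⟨_, (contractLeft_mapTower f (φ i) (ψ i) (fun x => by simp [f, φ, ψ]) y).symm⟩
    · exact fun i => contractLeft_map_eq_zero j (ψ i) (fun x => by simp [j, ψ]) w
    · set q := ((List.finRange n).map fun i => ι K (ξ i)).prod * ExteriorAlgebra.map j w with hq
      have h1 : n.factorial • ((-1) ^ u * q) ∈ R := by
        rw [← hu, Matrix.trace]
        refine Subalgebra.sum_mem _ fun i _ => ?_
        refine matrix_mul_mem_subalgebra R ?_ (matrix_pow_mem_subalgebra R ?_ n) i i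
        · intro i j
          obtain ⟨s, hs⟩ := hb₀ i j
          rw [mulMatrixTensor_tmul, ← hs, algebraMap_smul]
          exact Subalgebra.smul_mem _ (Subalgebra.one_mem _) _
        · intro i' j'
          rw [Matrix.sum_apply]
          refine Subalgebra.sum_mem _ fun l _ => ?_
          rw [Matrix.scalar_apply, Matrix.diagonal_mul]
          refine Subalgebra.mul_mem _ ⟨ι S (0, Pi.single l 1), ?_⟩ ?_
          · change mapTower K f _ = _
            rw [mapTower_ι]
            congr 1
            refine Prod.ext (by simp [f, ξ]) (funext fun a => ?_)
            by_cases h : a = l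
            · subst h; simp [f, ξ]
            · simp [f, ξ, h]
          · obtain ⟨s, hs⟩ := hb l i' j'
            refine ⟨ι S (KaehlerDifferential.D k S s, 0), ?_⟩
            change mapTower K f _ = ι K _
            rw [mapTower_ι, ← hs]
            congr 1
            refine Prod.ext (by simp [f, j]) (funext fun a => by simp [f, j])
      have h2 : (-1) ^ u * q ∈ R := by
        obtain ⟨c, hc⟩ := hn
        have h3 := Subalgebra.smul_mem R h1 (↑c⁻¹ : S)
        rwa [← Nat.cast_smul_eq_nsmul S, smul_smul, ← hc, Units.inv_mul, one_smul] at h3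
      have h3 := Subalgebra.mul_mem R (Subalgebra.pow_mem R
        (Subalgebra.neg_mem R (Subalgebra.one_mem R)) u) h2
      rwa [← mul_assoc, ← pow_add, Even.neg_one_pow ⟨u, rfl⟩, one_mul] at h3
  obtain ⟨y, hy⟩ := key
  have hy' : mapTower K f y = ExteriorAlgebra.map j w := hy
  -- Projecting away the auxiliary summand commutes with passing from `S` to `K` and gives back `w`.
  refine ⟨ExteriorAlgebra.map (LinearMap.fst S _ _) y, ?_⟩
  have e2 : ExteriorAlgebra.map (LinearMap.fst K (Ω[K⁄k]) (Fin n → K)) (mapTower K f y) =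
      DiffForms.pullback k S K (ExteriorAlgebra.map (LinearMap.fst S _ _) y) := by
    have : ((ExteriorAlgebra.map (LinearMap.fst K (Ω[K⁄k]) (Fin n → K))).restrictScalars S).comp
        (mapTower K f) = (DiffForms.pullback k S K).comp
          (ExteriorAlgebra.map (LinearMap.fst S _ _)) := by
      refine ExteriorAlgebra.hom_ext (LinearMap.ext fun x => ?_)
      change ExteriorAlgebra.map _ (mapTower K f (ι S x)) = mapTower K _ (ExteriorAlgebra.map _ _)
      rw [mapTower_ι, map_apply_ι, map_apply_ι, mapTower_ι]
      simp [f]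
    exact DFunLike.congr_fun this y
  change DiffForms.pullback k S K _ = w
  rw [← e2, hy', ← AlgHom.comp_apply, map_comp_map]
  simp [j]

end RegularTrace

/-! ### Differential forms under formally étale base change. -/

section FormallyEtale

open ExteriorAlgebra

@[simp] theorem DiffForms.pullback_ι (k A B : Type*) [CommRing k] [CommRing A] [CommRing B]
    [Algebra k A] [Algebra k B] [Algebra A B] [IsScalarTower k A B] (x : Ω[A⁄k]) :
    DiffForms.pullback k A B (ι A x) = ι B (KaehlerDifferential.map k k A B x) :=
  lift_ι_apply ..

/-- Pullback of forms is functorial. -/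
theorem DiffForms.pullback_pullback (k A B C : Type*) [CommRing k] [CommRing A] [CommRing B]
    [CommRing C] [Algebra k A] [Algebra k B] [Algebra k C] [Algebra A B] [Algebra B C] [Algebra A C]
    [IsScalarTower k A B] [IsScalarTower k B C] [IsScalarTower k A C] [IsScalarTower A B C]
    (ω : DiffForms k A) :
    DiffForms.pullback k B C (DiffForms.pullback k A B ω) = DiffForms.pullback k A C ω := by
  have : ((DiffForms.pullback k B C).restrictScalars A).comp (DiffForms.pullback k A B) =
      DiffForms.pullback k A C := by
    refine ExteriorAlgebra.hom_ext (LinearMap.ext fun x => ?_)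
    change DiffForms.pullback k B C (DiffForms.pullback k A B (ι A x)) =
      DiffForms.pullback k A C (ι A x)
    rw [pullback_ι, pullback_ι, pullback_ι]
    congr 1
    have h : ((KaehlerDifferential.map k k B C).restrictScalars A).comp
        (KaehlerDifferential.map k k A B) = KaehlerDifferential.map k k A C := by
      refine Derivation.liftKaehlerDifferential_unique _ _ (Derivation.ext fun a => ?_)
      simp [← IsScalarTower.algebraMap_apply]
    exact DFunLike.congr_fun h x
  exact DFunLike.congr_fun this ω

variable (k A T : Type*) [CommRing k] [CommRing A] [CommRing T]
  [Algebra k A] [Algebra k T] [Algebra A T] [IsScalarTower k A T]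

theorem commute_ofId_pullback (t : T) (ω : DiffForms k A) :
    Commute (Algebra.ofId T (DiffForms k T) t) (DiffForms.pullback k A T ω) :=
  Algebra.commutes t _

/-- The morphism `T ⊗ Ω^•_A → Ω^•_T` induced by the pullback of forms. -/
def DiffForms.baseChange : T ⊗[A] DiffForms k A →ₐ[T] DiffForms k T :=
  Algebra.TensorProduct.lift (Algebra.ofId T _) (DiffForms.pullback k A T)
    (commute_ofId_pullback k A T)

theorem DiffForms.baseChange_tmul (t : T) (ω : DiffForms k A) :
    DiffForms.baseChange k A T (t ⊗ₜ[A] ω) = t • DiffForms.pullback k A T ω := by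
  rw [DiffForms.baseChange, Algebra.TensorProduct.lift_tmul, Algebra.ofId_apply, Algebra.smul_def]

theorem DiffForms.baseChange_tensorι (x : T ⊗[A] Ω[A⁄k]) :
    DiffForms.baseChange k A T (tensorι A T _ x) =
      ι T (KaehlerDifferential.mapBaseChange k A T x) := by
  induction x with
  | zero => simp
  | tmul t v => simp [DiffForms.baseChange_tmul]
  | add x y hx hy => simp only [map_add, hx, hy]

variable [Algebra.FormallyEtale A T]

/-- The inverse of `DiffForms.baseChange` for a formally étale algebra. -/
def DiffForms.baseChangeInv : DiffForms k T →ₐ[T] T ⊗[A] DiffForms k A :=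
  ExteriorAlgebra.lift T ⟨tensorι A T _ ∘ₗ
    (KaehlerDifferential.tensorKaehlerEquivOfFormallyEtale k A T).symm.toLinearMap,
    fun _ => tensorι_mul_self _⟩

theorem DiffForms.baseChangeInv_ι (x : Ω[T⁄k]) :
    DiffForms.baseChangeInv k A T (ι T x) =
      tensorι A T _ ((KaehlerDifferential.tensorKaehlerEquivOfFormallyEtale k A T).symm x) :=
  lift_ι_apply ..

/-- Forms on a formally étale algebra are obtained by base change. -/
def DiffForms.baseChangeEquiv : (T ⊗[A] DiffForms k A) ≃ₐ[T] DiffForms k T :=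
  AlgEquiv.ofAlgHom (DiffForms.baseChange k A T) (DiffForms.baseChangeInv k A T)
    (by
      refine ExteriorAlgebra.hom_ext (LinearMap.ext fun x => ?_)
      change DiffForms.baseChange k A T (DiffForms.baseChangeInv k A T (ι T x)) = ι T x
      rw [baseChangeInv_ι, baseChange_tensorι,
        ← KaehlerDifferential.tensorKaehlerEquivOfFormallyEtale_apply,
        LinearEquiv.apply_symm_apply])
    (by
      refine Algebra.TensorProduct.ext (by ext) (ExteriorAlgebra.hom_ext (LinearMap.ext fun x => ?_))
      change DiffForms.baseChangeInv k A T (DiffForms.baseChange k A T (1 ⊗ₜ[A] ι A x)) =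
        1 ⊗ₜ[A] ι A x
      rw [baseChange_tmul, one_smul, pullback_ι, baseChangeInv_ι, ← tensorι_tmul]
      congr 1
      rw [LinearEquiv.symm_apply_eq]
      simp)

theorem DiffForms.baseChangeEquiv_tmul (t : T) (ω : DiffForms k A) :
    DiffForms.baseChangeEquiv k A T (t ⊗ₜ[A] ω) = t • DiffForms.pullback k A T ω :=
  baseChange_tmul ..

theorem DiffForms.baseChangeEquiv_symm_ι (x : Ω[T⁄k]) :
    (DiffForms.baseChangeEquiv k A T).symm (ι T x) =
      tensorι A T _ ((KaehlerDifferential.tensorKaehlerEquivOfFormallyEtale k A T).symm x) :=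
  baseChangeInv_ι ..

theorem DiffForms.baseChangeEquiv_symm_pullback (ω : DiffForms k A) :
    (DiffForms.baseChangeEquiv k A T).symm (DiffForms.pullback k A T ω) = 1 ⊗ₜ[A] ω := by
  rw [AlgEquiv.symm_apply_eq, baseChangeEquiv_tmul, one_smul]

end FormallyEtale

/-! ### Construction and uniqueness of the trace. -/

section TraceOfForms

open ExteriorAlgebra

variable (k A B K L : Type*) [CommRing k] [CommRing A] [CommRing B] [Field K] [Field L]
  [Algebra k A] [Algebra k B] [Algebra A B] [IsScalarTower k A B]
  [Algebra A K] [Algebra B L] [Algebra A L] [IsScalarTower A B L] [Algebra K L]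
  [IsScalarTower A K L] [Algebra k K] [IsScalarTower k A K] [Algebra k L] [IsScalarTower k B L]
  [IsScalarTower k K L] [IsScalarTower k A L]
  [Algebra.FormallyEtale A K] [Algebra.FormallyEtale B L] [Algebra.FormallyEtale K L]

/-- The trace on meromorphic forms. -/
def formTrace : MeroForms k B L →+ MeroForms k A K :=
  (DiffForms.baseChangeEquiv k A K).symm.toRingEquiv.toAddMonoidHom.comp
    ((traceTensor K L (DiffForms k K)).toAddMonoidHom.comp
      ((DiffForms.baseChangeEquiv k K L).symm.toRingEquiv.toAddMonoidHom.comp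
        (DiffForms.baseChangeEquiv k B L).toRingEquiv.toAddMonoidHom))

theorem formTrace_apply (η : MeroForms k B L) :
    formTrace k A B K L η = (DiffForms.baseChangeEquiv k A K).symm
      (traceTensor K L (DiffForms k K) ((DiffForms.baseChangeEquiv k K L).symm
        (DiffForms.baseChangeEquiv k B L η))) := rfl

/-- Through `B` or through `K`, a form of `A` has the same pullback to `L`. -/
theorem baseChangeEquiv_symm_baseChangeEquiv_pullback (ω : DiffForms k A) :
    (DiffForms.baseChangeEquiv k K L).symm
      (DiffForms.baseChangeEquiv k B L (1 ⊗ₜ[B] DiffForms.pullback k A B ω)) =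
      1 ⊗ₜ[K] DiffForms.pullback k A K ω := by
  rw [AlgEquiv.symm_apply_eq, DiffForms.baseChangeEquiv_tmul, DiffForms.baseChangeEquiv_tmul,
    DiffForms.pullback_pullback, DiffForms.pullback_pullback]

theorem isFormTrace_formTrace : IsFormTrace k A B K L (formTrace k A B K L) where
  degree_zero l := by
    rw [formTrace_apply, AlgEquiv.symm_apply_eq, DiffForms.baseChangeEquiv_tmul,
      DiffForms.baseChangeEquiv_tmul, map_one, map_one, map_smul, map_one,
      Algebra.TensorProduct.one_def, TensorProduct.smul_tmul', traceTensor_tmul, smul_eq_mul,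
      mul_one]
  map_wedge ω η := by
    rw [formTrace_apply, formTrace_apply, map_mul, map_mul,
      baseChangeEquiv_symm_baseChangeEquiv_pullback, traceTensor_one_tmul_mul, map_mul,
      DiffForms.baseChangeEquiv_symm_pullback]

variable {k A B K L}

theorem IsFormTrace.apply_tmul_pullback {Tr : MeroForms k B L →+ MeroForms k A K}
    (h : IsFormTrace k A B K L Tr) (l : L) (ω : DiffForms k A) :
    Tr (l ⊗ₜ[B] DiffForms.pullback k A B ω) = Algebra.trace K L l ⊗ₜ[A] ω := by
  have := h.map_wedge ω (l ⊗ₜ[B] 1)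
  rw [h.degree_zero, Algebra.TensorProduct.tmul_mul_tmul, Algebra.TensorProduct.tmul_mul_tmul,
    one_mul, one_mul, mul_one, mul_one] at this
  exact this

/-- Meromorphic forms of `B` are sums of multiples of pullbacks of forms of `A`. -/
theorem IsFormTrace.unique [Algebra.FormallyEtale A L]
    {Tr Tr' : MeroForms k B L →+ MeroForms k A K}
    (h : IsFormTrace k A B K L Tr) (h' : IsFormTrace k A B K L Tr') : Tr' = Tr := by
  -- Since `A → L` is formally étale, every form on `L` comes from some `z`; on pure tensors the two
  -- axioms determine the trace.
  have key : ∀ (z : L ⊗[A] DiffForms k A) (η : MeroForms k B L),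
      DiffForms.baseChangeEquiv k B L η = DiffForms.baseChangeEquiv k A L z → Tr' η = Tr η := by
    intro z
    induction z with
    | zero =>
      intro η hη
      rw [map_zero, map_eq_zero_iff _ (AlgEquiv.injective _)] at hη
      rw [hη, map_zero, map_zero]
    | tmul l ω =>
      intro η hη
      rw [DiffForms.baseChangeEquiv_tmul, ← DiffForms.pullback_pullback k A B L,
        ← DiffForms.baseChangeEquiv_tmul] at hη
      rw [AlgEquiv.injective _ hη, h.apply_tmul_pullback, h'.apply_tmul_pullback]
    | add z₁ z₂ h₁ h₂ =>
      intro η hη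
      have e : η = (DiffForms.baseChangeEquiv k B L).symm (DiffForms.baseChangeEquiv k A L z₁) +
          (DiffForms.baseChangeEquiv k B L).symm (DiffForms.baseChangeEquiv k A L z₂) := by
        rw [← map_add, ← map_add, ← hη, AlgEquiv.symm_apply_apply]
      rw [e, map_add, map_add, h₁ _ (AlgEquiv.apply_symm_apply _ _),
        h₂ _ (AlgEquiv.apply_symm_apply _ _)]
  refine AddMonoidHom.ext fun η => ?_
  exact key ((DiffForms.baseChangeEquiv k A L).symm (DiffForms.baseChangeEquiv k B L η)) η
    (AlgEquiv.apply_symm_apply _ _).symm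

end TraceOfForms

/-! ### Homogeneous elements after base change. -/

section Degree

open ExteriorAlgebra

variable (A T M : Type*) [CommRing A] [CommRing T] [Algebra A T] [AddCommGroup M] [Module A M]

/-- The homogeneous elements of degree `n` of `T ⊗ ⋀ M`. -/
def tensorDegree (n : ℕ) : Submodule T (T ⊗[A] ExteriorAlgebra A M) :=
  Submodule.span T {x | ∃ w ∈ ⋀[A]^n M, x = 1 ⊗ₜ[A] w}

variable {A T M}

theorem tensorι_mul_mem_tensorDegree (x : T ⊗[A] M) {n : ℕ} {y : T ⊗[A] ExteriorAlgebra A M}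
    (hy : y ∈ tensorDegree A T M n) : tensorι A T M x * y ∈ tensorDegree A T M (n + 1) := by
  induction x with
  | zero => simp
  | add x₁ x₂ h₁ h₂ => rw [map_add, add_mul]; exact add_mem h₁ h₂
  | tmul t v =>
    induction hy using Submodule.span_induction with
    | mem y hy =>
      obtain ⟨w, hw, rfl⟩ := hy
      have : tensorι A T M (t ⊗ₜ[A] v) * (1 ⊗ₜ[A] w) = t • ((1 : T) ⊗ₜ[A] (ι A v * w)) := by
        simp [TensorProduct.smul_tmul']
      rw [this]
      refine Submodule.smul_mem _ _ (Submodule.subset_span ⟨_, ?_, rfl⟩)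
      rw [exteriorPower, pow_succ']
      exact Submodule.mul_mem_mul (LinearMap.mem_range_self _ v) hw
    | zero => simp
    | add y z _ _ h₁ h₂ => rw [mul_add]; exact add_mem h₁ h₂
    | smul c y _ h => rw [mul_smul_comm]; exact Submodule.smul_mem _ _ h

theorem prod_tensorι_mem_tensorDegree (l : List (T ⊗[A] M)) :
    (l.map (tensorι A T M)).prod ∈ tensorDegree A T M l.length := by
  induction l with
  | nil =>
    refine Submodule.subset_span ⟨1, ?_, rfl⟩
    rw [List.length_nil, exteriorPower, pow_zero]
    exact Submodule.one_le.1 le_rfl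
  | cons x l ih =>
    rw [List.map_cons, List.prod_cons]
    exact tensorι_mul_mem_tensorDegree x ih

theorem traceTensor_mem_exteriorPower {K L V : Type*} [CommRing K] [CommRing L] [Algebra K L]
    [AddCommGroup V] [Module K V] {n : ℕ} {x : L ⊗[K] ExteriorAlgebra K V}
    (hx : x ∈ tensorDegree K L V n) : traceTensor K L _ x ∈ ⋀[K]^n V := by
  -- The trace is not `L`-linear, so the induction over the `L`-span must carry an arbitrary
  -- multiplier.
  have hx' : ∀ l : L, traceTensor K L _ (l • x) ∈ ⋀[K]^n V := by
    induction hx using Submodule.span_induction with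
    | mem y hy =>
      obtain ⟨w, hw, rfl⟩ := hy
      intro l
      rw [TensorProduct.smul_tmul', traceTensor_tmul]
      exact Submodule.smul_mem _ _ hw
    | zero => simp
    | add y z _ _ h₁ h₂ => intro l; rw [smul_add, map_add]; exact add_mem (h₁ l) (h₂ l)
    | smul c y _ h => intro l; rw [smul_smul]; exact h _
  simpa using hx' 1

/-- A form that is regular and homogeneous of degree `n` comes from a regular form of degree
`n`. -/
theorem exists_mem_exteriorPower_of_mem_tensorDegree {n : ℕ} {η : ExteriorAlgebra A M}
    (h : (1 : T) ⊗ₜ[A] η ∈ tensorDegree A T M n) :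
    ∃ η' ∈ ⋀[A]^n M, (1 : T) ⊗ₜ[A] η = 1 ⊗ₜ[A] η' := by
  -- The projection to degree `n`: its base change fixes `1 ⊗ η`, so `p η` can replace `η` even if
  -- `T ⊗ -` is not faithful.
  let p : ExteriorAlgebra A M →ₗ[A] ExteriorAlgebra A M :=
    (⋀[A]^n M).subtype ∘ₗ DirectSum.component A ℕ (fun i => ⋀[A]^i M) n ∘ₗ
      (DirectSum.decomposeLinearEquiv (fun i : ℕ => ⋀[A]^i M)).toLinearMap
  have hp : ∀ w ∈ ⋀[A]^n M, p w = w := by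
    intro w hw
    exact DirectSum.decompose_of_mem_same (fun i : ℕ => ⋀[A]^i M) hw
  have hp' : ∀ x ∈ tensorDegree A T M n, p.baseChange T x = x := by
    intro x hx
    induction hx using Submodule.span_induction with
    | mem y hy =>
      obtain ⟨w, hw, rfl⟩ := hy
      rw [LinearMap.baseChange_tmul, hp w hw]
    | zero => simp
    | add y z _ _ h₁ h₂ => rw [map_add, h₁, h₂]
    | smul c y _ h => rw [map_smul, h]
  refine ⟨p η, Subtype.property _, ?_⟩
  rw [← hp' _ h, LinearMap.baseChange_tmul]

end Degree

/-! ### The trace preserves degree and is regular over suitable `S`. -/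

section TraceDegree

open ExteriorAlgebra

/-- The inverse base change of forms preserves degrees. -/
theorem baseChangeEquiv_symm_mem_tensorDegree (k A T : Type*) [CommRing k] [CommRing A] [CommRing T]
    [Algebra k A] [Algebra k T] [Algebra A T] [IsScalarTower k A T] [Algebra.FormallyEtale A T]
    {n : ℕ} {ω : DiffForms k T} (hω : ω ∈ ⋀[T]^n (Ω[T⁄k])) :
    (DiffForms.baseChangeEquiv k A T).symm ω ∈ tensorDegree A T _ n := by
  rw [← ιMulti_span_fixedDegree] at hω
  induction hω using Submodule.span_induction with
  | mem y hy =>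
    obtain ⟨v, rfl⟩ := hy
    rw [ιMulti_apply, map_list_prod, List.map_ofFn]
    have := prod_tensorι_mem_tensorDegree (List.ofFn fun i =>
      (KaehlerDifferential.tensorKaehlerEquivOfFormallyEtale k A T).symm (v i))
    rw [List.map_ofFn, List.length_ofFn] at this
    have e : (⇑(DiffForms.baseChangeEquiv k A T).symm ∘ fun i => ι T (v i)) =
        ⇑(tensorι A T (Ω[A⁄k])) ∘ fun i =>
          (KaehlerDifferential.tensorKaehlerEquivOfFormallyEtale k A T).symm (v i) :=
      funext fun i => DiffForms.baseChangeEquiv_symm_ι k A T (v i)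
    rw [e]
    exact this
  | zero => simp
  | add y z _ _ h₁ h₂ => rw [map_add]; exact add_mem h₁ h₂
  | smul c y _ h => rw [map_smul]; exact Submodule.smul_mem _ _ h

/-- The pullback of forms preserves degrees. -/
theorem pullback_mem_exteriorPower (k A T : Type*) [CommRing k] [CommRing A] [CommRing T]
    [Algebra k A] [Algebra k T] [Algebra A T] [IsScalarTower k A T]
    {n : ℕ} {ω : DiffForms k A} (hω : ω ∈ ⋀[A]^n (Ω[A⁄k])) :
    DiffForms.pullback k A T ω ∈ ⋀[T]^n (Ω[T⁄k]) := by
  rw [← ιMulti_span_fixedDegree] at hω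
  induction hω using Submodule.span_induction with
  | mem y hy =>
    obtain ⟨v, rfl⟩ := hy
    have : DiffForms.pullback k A T (ιMulti A n v) =
        ιMulti T n fun i => KaehlerDifferential.map k k A T (v i) := by
      rw [ιMulti_apply, map_list_prod, List.map_ofFn, ιMulti_apply]
      congr 2
      exact funext fun i => DiffForms.pullback_ι ..
    rw [this]
    exact (exteriorPower.ιMulti T n _).2
  | zero => simp
  | add y z _ _ h₁ h₂ => rw [map_add]; exact add_mem h₁ h₂
  | smul c y _ h =>
    rw [map_smul, ← algebraMap_smul T]; exact Submodule.smul_mem _ _ h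

variable (k A B K L : Type*) [CommRing k] [CommRing A] [CommRing B] [Field K] [Field L]
  [Algebra k A] [Algebra k B] [Algebra A B] [IsScalarTower k A B]
  [Algebra A K] [Algebra B L] [Algebra A L] [IsScalarTower A B L] [Algebra K L]
  [IsScalarTower A K L] [Algebra k K] [IsScalarTower k A K] [Algebra k L] [IsScalarTower k B L]
  [IsScalarTower k K L] [IsScalarTower k A L]
  [Algebra.FormallyEtale A K] [Algebra.FormallyEtale B L] [Algebra.FormallyEtale K L]

theorem formTrace_mem_tensorDegree {n : ℕ} {ω : DiffForms k B} (hω : ω ∈ ⋀[B]^n (Ω[B⁄k])) :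
    formTrace k A B K L (1 ⊗ₜ[B] ω) ∈ tensorDegree A K _ n := by
  rw [formTrace_apply, DiffForms.baseChangeEquiv_tmul, one_smul]
  exact baseChangeEquiv_symm_mem_tensorDegree k A K (traceTensor_mem_exteriorPower
    (baseChangeEquiv_symm_mem_tensorDegree k K L (pullback_mem_exteriorPower k B L hω)))

/-- The trace of a regular form on `B` is regular over `S`, where `S ⊆ K` contains the entries of
the matrices of multiplication by elements of `B` in a basis of `L` over `K`. -/
theorem baseChangeEquiv_formTrace_mem_range_pullback (S : Type*) [CommRing S] [Algebra k S]
    [Algebra S K] [IsScalarTower k S K]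
    {m : Type*} [Fintype m] [DecidableEq m] (e : Module.Basis m K L)
    (he : ∀ (b : B) i j, Algebra.leftMulMatrix e (algebraMap B L b) i j ∈ (algebraMap S K).range)
    {n : ℕ} (hn : IsUnit (n.factorial : S))
    {ω : DiffForms k B} (hω : ω ∈ ⋀[B]^n (Ω[B⁄k])) :
    DiffForms.baseChangeEquiv k A K (formTrace k A B K L (1 ⊗ₜ[B] ω)) ∈
      (DiffForms.pullback k S K).range := by
  let D : L →+ L ⊗[K] Ω[K⁄k] :=
    (KaehlerDifferential.tensorKaehlerEquivOfFormallyEtale k K L).symm.toLinearMap.toAddMonoidHom.comp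
      (KaehlerDifferential.D k L).toLinearMap.toAddMonoidHom
  have hDapp : ∀ x, D x = (KaehlerDifferential.tensorKaehlerEquivOfFormallyEtale k K L).symm
    (KaehlerDifferential.D k L x) := fun _ => rfl
  have hD : ∀ x y, D (x * y) = x • D y + y • D x := fun x y => by
    rw [hDapp, hDapp, hDapp, Derivation.leibniz, map_add, map_smul, map_smul]
  have hd : ∀ x : K, D (algebraMap K L x) = 1 ⊗ₜ[K] KaehlerDifferential.D k K x := fun x => by
    rw [hDapp, KaehlerDifferential.tensorKaehlerEquivOfFormallyEtale_symm_D_algebraMap]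
  -- The `n`-forms are the `B`-span of products of exact differentials; the multiplier `b₀` makes
  -- the induction over this span work and becomes the leading coefficient of the trace formula.
  have key : ∀ b₀ : B, DiffForms.baseChangeEquiv k A K
      (formTrace k A B K L (1 ⊗ₜ[B] (b₀ • ω))) ∈ (DiffForms.pullback k S K).range := by
    have hs := exteriorPower.ιMulti_span_fixedDegree_of_span_eq_top B n (Ω[B⁄k])
      (KaehlerDifferential.span_range_derivation k B)
    rw [← hs] at hω
    induction hω using Submodule.span_induction with
    | mem y hy =>
      obtain ⟨v, hv, rfl⟩ := hy
      choose b hb using fun i => hv ⟨i, rfl⟩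
      intro b₀
      have h := traceTensor_mem_range_pullback k S K L e D hD hd hn (algebraMap B L b₀)
        (fun i => algebraMap B L (b i)) (he b₀) (fun i => he (b i))
      convert h using 1
      rw [formTrace_apply, AlgEquiv.apply_symm_apply, DiffForms.baseChangeEquiv_tmul, one_smul,
        map_smul, ← algebraMap_smul L, map_smul, Algebra.smul_def]
      congr 2
      rw [ιMulti_apply, map_list_prod, map_list_prod, List.map_ofFn, List.map_ofFn, List.ofFn_eq_map]
      congr 1
      refine List.map_congr_left fun i _ => ?_
      simp only [Function.comp_apply]
      rw [DiffForms.pullback_ι, DiffForms.baseChangeEquiv_symm_ι, hDapp, ← hb,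
        KaehlerDifferential.map_D]
    | zero => intro b₀; simp
    | add y z _ _ h₁ h₂ =>
      intro b₀
      rw [smul_add, TensorProduct.tmul_add, map_add, map_add]
      exact add_mem (h₁ b₀) (h₂ b₀)
    | smul c y _ h => intro b₀; rw [smul_smul]; exact h _
  simpa using key 1

end TraceDegree

/-! ### Reduction to primes with principal localization. -/

section CodimensionOne

variable {A K : Type*} [CommRing A] [IsDomain A] [Field K] [Algebra A K] [IsFractionRing A K]

/-- The localization of a noetherian integrally closed domain at an associated prime of `K ⧸ A` is
a principal ideal ring. -/
theorem isPrincipalIdealRing_of_mem_iff_mul_mem [IsNoetherianRing A] [IsIntegrallyClosed A]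
    (p : Ideal A) [p.IsPrime] (c : K)
    (hc : ∀ a, a ∈ p ↔ ∃ a', algebraMap A K a * c = algebraMap A K a')
    (S : Type*) [CommRing S] [Algebra A S] [IsLocalization.AtPrime S p] [Algebra S K]
    [IsScalarTower A S K] : IsPrincipalIdealRing S := by
  have hle : p.primeCompl ≤ nonZeroDivisors A := p.primeCompl_le_nonZeroDivisors
  have : IsDomain S := IsLocalization.isDomain_of_le_nonZeroDivisors S hle
  have : IsLocalRing S := IsLocalization.AtPrime.isLocalRing S p
  have : IsNoetherianRing S := IsLocalization.isNoetherianRing p.primeCompl S inferInstance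
  have : IsIntegrallyClosed S := isIntegrallyClosed_of_isLocalization S p.primeCompl hle
  have : IsFractionRing S K :=
    IsFractionRing.isFractionRing_of_isDomain_of_isLocalization p.primeCompl S K
  have hinj := IsFractionRing.injective S K
  -- By `hc`, `p` is the ideal of denominators of `c`; hence `c` carries the maximal ideal `m` of
  -- `S` into `S`, although `c ∉ S`.
  have hmul : ∀ u ∈ IsLocalRing.maximalIdeal S, ∃ y, algebraMap S K u * c = algebraMap S K y := by
    intro u hu
    obtain ⟨a, s, rfl⟩ := IsLocalization.exists_mk'_eq p.primeCompl u
    have ha : a ∈ p := (IsLocalization.AtPrime.mk'_mem_maximal_iff S p a s).1 hu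
    obtain ⟨a', ha'⟩ := (hc a).1 ha
    refine ⟨IsLocalization.mk' S a' s, ?_⟩
    have hs : algebraMap A K s ≠ 0 := by
      rw [Ne, IsFractionRing.to_map_eq_zero_iff]
      exact nonZeroDivisors.ne_zero (hle s.2)
    have h1 : ∀ b : A, algebraMap A K s * algebraMap S K (IsLocalization.mk' S b s) =
        algebraMap A K b := fun b => by
      rw [IsScalarTower.algebraMap_apply A S K, ← map_mul, IsLocalization.mk'_spec',
        ← IsScalarTower.algebraMap_apply]
    refine mul_left_cancel₀ hs ?_
    rw [← mul_assoc, h1, h1, ha']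
  have hcS : ∀ y : S, algebraMap S K y ≠ c := by
    rintro y rfl
    obtain ⟨a, s, rfl⟩ := IsLocalization.exists_mk'_eq p.primeCompl y
    refine s.2 ((hc s).2 ⟨a, ?_⟩)
    rw [IsScalarTower.algebraMap_apply A S K, ← map_mul, IsLocalization.mk'_spec',
      ← IsScalarTower.algebraMap_apply]
  have hm0 : ∃ u ∈ IsLocalRing.maximalIdeal S, u ≠ 0 := by
    obtain ⟨a, s, hs, rfl⟩ := IsFractionRing.div_surjective (A := A) c
    have hs0 : algebraMap A K s ≠ 0 := by
      rw [Ne, IsFractionRing.to_map_eq_zero_iff]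
      exact nonZeroDivisors.ne_zero hs
    have hsp : s ∈ p := (hc s).2 ⟨a, mul_div_cancel₀ _ hs0⟩
    refine ⟨algebraMap A S s, (IsLocalization.AtPrime.to_map_mem_maximal_iff S p s).2 hsp, ?_⟩
    intro h0
    apply hs0
    rw [IsScalarTower.algebraMap_apply A S K, h0, map_zero]
  -- If `c m ⊆ m`, then `c` is integral, as it stabilizes a nonzero finite module, and so lies in
  -- `S`: a contradiction. Otherwise `t c` is a unit for some `t ∈ m`, and `m = (t)`.
  by_cases hcase : ∀ u ∈ IsLocalRing.maximalIdeal S, ∀ y,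
      algebraMap S K u * c = algebraMap S K y → y ∈ IsLocalRing.maximalIdeal S
  · exfalso
    have hint : IsIntegral S c := by
      refine isIntegral_of_smul_mem_submodule
        (Submodule.map (Algebra.linearMap S K) (IsLocalRing.maximalIdeal S)) ?_ ?_ c ?_
      · obtain ⟨u, hu, hu0⟩ := hm0
        rw [Submodule.ne_bot_iff]
        refine ⟨algebraMap S K u, ⟨u, hu, rfl⟩, ?_⟩
        rwa [Ne, map_eq_zero_iff _ hinj]
      · exact Submodule.FG.map _ (IsNoetherian.noetherian _)
      · rintro _ ⟨u, hu, rfl⟩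
        obtain ⟨y, hy⟩ := hmul u hu
        exact ⟨y, hcase u hu y hy, by rw [smul_eq_mul, mul_comm]; exact hy.symm⟩
    obtain ⟨y, hy⟩ := IsIntegrallyClosed.algebraMap_eq_of_integral hint
    exact hcS y hy
  · push Not at hcase
    obtain ⟨t, ht, y, hty, hy⟩ := hcase
    obtain ⟨v, rfl⟩ : IsUnit y := by
      by_contra h
      exact hy ((IsLocalRing.mem_maximalIdeal y).2 h)
    have hspan : IsLocalRing.maximalIdeal S = Ideal.span {t} := by
      refine le_antisymm (fun u hu => ?_) ((Ideal.span_singleton_le_iff_mem _).2 ht)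
      obtain ⟨z, hz⟩ := hmul u hu
      refine Ideal.mem_span_singleton'.2 ⟨z * ↑v⁻¹, hinj ?_⟩
      have h1 : algebraMap S K (↑v⁻¹ : S) * algebraMap S K v = 1 := by
        rw [← map_mul, Units.inv_mul, map_one]
      rw [map_mul, map_mul, ← hz]
      calc algebraMap S K u * c * algebraMap S K ↑v⁻¹ * algebraMap S K t
          = algebraMap S K u * (algebraMap S K ↑v⁻¹ * (algebraMap S K t * c)) := by ring
        _ = algebraMap S K u := by rw [hty, h1, mul_one]
    have hprin : Submodule.IsPrincipal (IsLocalRing.maximalIdeal S) := ⟨t, hspan⟩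
    exact ((tfae_of_isNoetherianRing_of_isLocalRing_of_isDomain S).out 0 4).2 hprin

/-- An element of the fraction field of a noetherian integrally closed domain that is regular at
all primes where the localization is a principal ideal ring is regular. -/
theorem mem_range_algebraMap_of_forall_prime [IsNoetherianRing A] [IsIntegrallyClosed A] (c : K)
    (h : ∀ (p : Ideal A) [p.IsPrime], IsPrincipalIdealRing
      (Localization.subalgebra K p.primeCompl p.primeCompl_le_nonZeroDivisors) →
      ∃ s ∉ p, ∃ a, algebraMap A K s * c = algebraMap A K a) :
    ∃ a, algebraMap A K a = c := by
  by_contra hcA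
  let N : Submodule A K := LinearMap.range (Algebra.linearMap A K)
  have hmem : ∀ (x : K) (a : A), a ∈ (⊥ : Submodule A (K ⧸ N)).colon {Submodule.Quotient.mk x} ↔
      ∃ a', algebraMap A K a * x = algebraMap A K a' := by
    intro x a
    rw [Submodule.mem_colon_singleton, Submodule.mem_bot, ← Submodule.Quotient.mk_smul,
      Submodule.Quotient.mk_eq_zero, Algebra.smul_def]
    exact ⟨fun ⟨a', ha'⟩ => ⟨a', ha'.symm⟩, fun ⟨a', ha'⟩ => ⟨a', ha'.symm⟩⟩
  have hne : (Submodule.Quotient.mk c : K ⧸ N) ≠ 0 := by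
    rw [Ne, Submodule.Quotient.mk_eq_zero]
    rintro ⟨a, ha⟩
    exact hcA ⟨a, ha⟩
  -- An associated prime of `K ⧸ A` containing all denominators of `c`. It is itself the denominator
  -- ideal of some `x`, so the localization there is principal, and `h` yields a denominator of `c`
  -- outside it.
  obtain ⟨p, hp, hle⟩ := exists_le_isAssociatedPrime_of_isNoetherianRing A _ hne
  have hpp : p.IsPrime := hp.1
  obtain ⟨x, hx⟩ := (Submodule.isAssociatedPrime_iff.1 hp).2
  obtain ⟨x, rfl⟩ := Submodule.Quotient.mk_surjective _ x
  have hpid := isPrincipalIdealRing_of_mem_iff_mul_mem p x (fun a => by rw [← hmem, ← hx])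
    (Localization.subalgebra K p.primeCompl p.primeCompl_le_nonZeroDivisors)
  obtain ⟨s, hs, hs'⟩ := h p hpid
  exact hs (hle ((hmem c s).2 hs'))

/-- An element of `K ⊗ P`, for a projective module `P` over a noetherian integrally closed domain
`A`, that is regular at all primes where the localization of `A` is a principal ideal ring is
regular. -/
theorem exists_eq_one_tmul_of_forall_prime [IsNoetherianRing A] [IsIntegrallyClosed A]
    {P : Type*} [AddCommGroup P] [Module A P] [Module.Projective A P] (x : K ⊗[A] P)
    (h : ∀ (p : Ideal A) [p.IsPrime], IsPrincipalIdealRing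
      (Localization.subalgebra K p.primeCompl p.primeCompl_le_nonZeroDivisors) →
      ∃ s ∉ p, ∃ y : P, algebraMap A K s • x = 1 ⊗ₜ[A] y) :
    ∃ y : P, x = 1 ⊗ₜ[A] y := by
  classical
  -- Splitting `P` off a free module reduces regularity to that of each coordinate; the retraction
  -- `r` brings the result back to `P`.
  obtain ⟨i, hi⟩ := Module.projective_def'.1 (inferInstance : Module.Projective A P)
  let r : (P →₀ A) →ₗ[A] P := Finsupp.linearCombination A id
  let Φ : K ⊗[A] (P →₀ A) ≃ₗ[K] (P →₀ K) := TensorProduct.finsuppScalarRight A K K P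
  have hΦ : ∀ (y : P →₀ A) (q : P), Φ (1 ⊗ₜ[A] y) q = algebraMap A K (y q) := fun y q => by
    simp [Φ, TensorProduct.finsuppScalarRight_apply_tmul_apply, Algebra.smul_def]
  have hcoord : ∀ q, ∃ a, algebraMap A K a = Φ (i.baseChange K x) q := by
    intro q
    refine mem_range_algebraMap_of_forall_prime _ fun p _ hp => ?_
    obtain ⟨s, hs, y, hy⟩ := h p hp
    refine ⟨s, hs, i y q, ?_⟩
    rw [← hΦ, ← LinearMap.baseChange_tmul, ← hy, map_smul, map_smul, Finsupp.smul_apply,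
      smul_eq_mul]
  choose a ha using hcoord
  have hfin : (Function.support a).Finite := by
    refine (Φ (i.baseChange K x)).hasFiniteSupport.subset fun q hq => ?_
    rw [Function.mem_support, ← ha, Ne, IsFractionRing.to_map_eq_zero_iff]
    exact hq
  let y : P →₀ A := Finsupp.ofSupportFinite a hfin
  have hy : i.baseChange K x = 1 ⊗ₜ[A] y := by
    refine Φ.injective (Finsupp.ext fun q => ?_)
    rw [hΦ, ← ha]; rfl
  refine ⟨r y, ?_⟩
  rw [← LinearMap.baseChange_tmul, ← hy, ← LinearMap.comp_apply, ← LinearMap.baseChange_comp, hi,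
    LinearMap.baseChange_id, LinearMap.id_apply]

end CodimensionOne

/-- By functoriality the exterior algebra is a retract of that of a free module, which is free; the
linear order serves only to index its basis. -/
instance ExteriorAlgebra.projective (A M : Type*) [CommRing A] [AddCommGroup M] [Module A M]
    [Module.Projective A M] : Module.Projective A (ExteriorAlgebra A M) := by
  classical
  obtain ⟨i, hi⟩ := Module.projective_def'.1 (inferInstance : Module.Projective A M)
  let _ : LinearOrder M := linearOrderOfSTO WellOrderingRel
  have hfree : Module.Free A (ExteriorAlgebra A (M →₀ A)) :=
    Module.Free.of_basis (Module.Basis.ExteriorAlgebra (Finsupp.basisSingleOne (R := A) (ι := M)))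
  refine Module.Projective.of_split (ExteriorAlgebra.map i).toLinearMap
    (ExteriorAlgebra.map (Finsupp.linearCombination A id)).toLinearMap ?_
  refine LinearMap.ext fun x => ?_
  change ExteriorAlgebra.map _ (ExteriorAlgebra.map i x) = x
  rw [← AlgHom.comp_apply, ExteriorAlgebra.map_comp_map, hi, ExteriorAlgebra.map_id]
  rfl

/-! ### Smooth domains over a field are normal. -/

section Normality

/-- A domain that is étale over a domain is algebraic over it. -/
theorem isAlgebraic_of_etale (P A : Type*) [CommRing P] [IsDomain P] [CommRing A] [IsDomain A]
    [Algebra P A] [Algebra.Etale P A] : Algebra.IsAlgebraic P A := by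
  let F := FractionRing P
  -- Over the fraction field an étale algebra is finite, and flatness embeds `A` in it.
  have : Module.Finite F (F ⊗[P] A) := Algebra.FormallyUnramified.finite_of_free F (F ⊗[P] A)
  have hinj : Function.Injective
      (Algebra.TensorProduct.includeRight : A →ₐ[P] F ⊗[P] A) :=
    Algebra.TensorProduct.includeRight_injective (IsFractionRing.injective P F)
  refine ⟨fun a => ?_⟩
  rw [← isAlgebraic_algHom_iff _ hinj, IsFractionRing.isAlgebraic_iff P F]
  exact (Algebra.IsIntegral.isIntegral (R := F) _).isAlgebraic

/-- A domain that is étale over an integrally closed domain is integrally closed. -/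
theorem isIntegrallyClosed_of_etale (P A : Type*) [CommRing P] [IsDomain P] [IsIntegrallyClosed P]
    [CommRing A] [IsDomain A] [Algebra P A] [Algebra.Etale P A] : IsIntegrallyClosed A := by
  let F := FractionRing P
  let K := FractionRing A
  have := isAlgebraic_of_etale P A
  have : FaithfulSMul P A := inferInstance
  -- As `A` is algebraic over `P`, inverting the nonzero elements of `P` already gives the fraction
  -- field of `A`.
  let Φ : (A ⊗[P] F) ≃ₐ[A] K :=
    IsLocalization.algEquiv (Algebra.algebraMapSubmonoid A (nonZeroDivisors P)) _ _
  rw [isIntegrallyClosed_iff K]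
  intro x hx
  have hint : IsIntegral A (Φ.symm x) := hx.map Φ.symm
  -- Integral closure commutes with smooth base change, and that of `P` in `F` is `P`.
  obtain ⟨z, hz⟩ := (TensorProduct.toIntegralClosure_bijective_of_smooth (R := P) (S := A)
    (B := F)).2 ⟨Φ.symm x, hint⟩
  have key : ∀ z : A ⊗[P] integralClosure P F, ∃ a : A,
      (TensorProduct.toIntegralClosure P A F z : A ⊗[P] F) = a ⊗ₜ[P] 1 := by
    intro z
    induction z with
    | zero => exact ⟨0, by simp⟩
    | add z₁ z₂ h₁ h₂ =>
      obtain ⟨a₁, h₁⟩ := h₁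
      obtain ⟨a₂, h₂⟩ := h₂
      exact ⟨a₁ + a₂, by rw [map_add, AddMemClass.coe_add, h₁, h₂, TensorProduct.add_tmul]⟩
    | tmul a f =>
      obtain ⟨q, hq⟩ := IsIntegrallyClosed.algebraMap_eq_of_integral (K := F) (R := P) f.2
      refine ⟨q • a, ?_⟩
      change a ⊗ₜ[P] (f : F) = _
      rw [← hq, TensorProduct.smul_tmul, Algebra.algebraMap_eq_smul_one]
  obtain ⟨a, ha⟩ := key z
  refine ⟨a, ?_⟩
  rw [hz] at ha
  rw [← Φ.apply_symm_apply x]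
  change _ = Φ ((⟨Φ.symm x, hint⟩ : integralClosure A (A ⊗[P] F)) : A ⊗[P] F)
  rw [ha]
  exact (Φ.commutes a).symm

/-- A smooth domain over a field is integrally closed. -/
theorem isIntegrallyClosed_of_smooth (k A : Type*) [Field k] [CommRing A] [IsDomain A] [Algebra k A]
    [Algebra.Smooth k A] : IsIntegrallyClosed A := by
  let K := FractionRing A
  rw [isIntegrallyClosed_iff K]
  intro x hx
  -- The denominators of `x`. Near a maximal ideal containing them, `A` is étale over a polynomial
  -- ring, hence normal, which produces a denominator `f ^ r` outside that ideal.
  let I : Ideal A := (LinearMap.range (Algebra.linearMap A K)).colon {x}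
  have hI : ∀ a, a ∈ I ↔ ∃ y, algebraMap A K y = a • x := fun a => by
    rw [Submodule.mem_colon_singleton]; rfl
  suffices h : I = ⊤ by
    obtain ⟨y, hy⟩ := (hI 1).1 (h ▸ Submodule.mem_top)
    exact ⟨y, by rw [hy, one_smul]⟩
  by_contra hne
  obtain ⟨m, hm, hle⟩ := Ideal.exists_le_maximal I hne
  obtain ⟨f, hf, n, _, _, _⟩ :=
    Algebra.IsSmoothAt.exists_isStandardEtale_mvPolynomial (R := k) (p := m)
  have hf0 : f ≠ 0 := fun h => hf (h ▸ m.zero_mem)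
  have hpow : Submonoid.powers f ≤ nonZeroDivisors A :=
    powers_le_nonZeroDivisors_of_noZeroDivisors hf0
  have : IsDomain (Localization.Away f) := IsLocalization.isDomain_of_le_nonZeroDivisors _ hpow
  have hcl : IsIntegrallyClosed (Localization.Away f) :=
    isIntegrallyClosed_of_etale (MvPolynomial (Fin n) k) (Localization.Away f)
  let g : Localization.Away f →+* K :=
    IsLocalization.map K (T := nonZeroDivisors A) (RingHom.id A) hpow
  let _ := g.toAlgebra
  have : IsScalarTower A (Localization.Away f) K := IsScalarTower.of_algebraMap_eq fun a =>
    (IsLocalization.map_eq (g := RingHom.id A) hpow a).symm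
  have := IsFractionRing.isFractionRing_of_isDomain_of_isLocalization (Submonoid.powers f)
    (Localization.Away f) K
  obtain ⟨y, hy⟩ := (isIntegrallyClosed_iff K).1 hcl (hx.tower_top (A := Localization.Away f))
  obtain ⟨a, ⟨s, r, rfl⟩, rfl⟩ := IsLocalization.exists_mk'_eq (Submonoid.powers f) y
  have hr : f ^ r ∈ I := by
    refine (hI _).2 ⟨a, ?_⟩
    rw [← hy, Algebra.smul_def, IsScalarTower.algebraMap_apply A (Localization.Away f) K,
      IsScalarTower.algebraMap_apply A (Localization.Away f) K, ← map_mul]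
    congr 1
    exact (IsLocalization.mk'_spec' _ a (⟨f ^ r, r, rfl⟩ : Submonoid.powers f)).symm
  exact hf (hm.isPrime.mem_of_pow_mem r (hle hr))

end Normality

/-! ### Forms on a localization and integral bases. -/

section Localization

/-- Every form on a localization is a fraction of a form. -/
theorem exists_smul_eq_pullback (k A S : Type*) [CommRing k] [CommRing A] [CommRing S]
    [Algebra k A] [Algebra k S] [Algebra A S] [IsScalarTower k A S] (M : Submonoid A)
    [IsLocalization M S] (y : DiffForms k S) :
    ∃ s ∈ M, ∃ ω : DiffForms k A, algebraMap A S s • y = DiffForms.pullback k A S ω := by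
  have : Algebra.FormallyEtale A S := Algebra.FormallyEtale.of_isLocalization M
  obtain ⟨z, rfl⟩ := (DiffForms.baseChangeEquiv k A S).surjective y
  have key : ∃ s ∈ M, ∃ ω : DiffForms k A, algebraMap A S s • z = 1 ⊗ₜ[A] ω := by
    induction z with
    | zero => exact ⟨1, M.one_mem, 0, by simp⟩
    | tmul t ω =>
      obtain ⟨a, s, rfl⟩ := IsLocalization.exists_mk'_eq M t
      refine ⟨s, s.2, a • ω, ?_⟩
      rw [TensorProduct.smul_tmul', smul_eq_mul, IsLocalization.mk'_spec',
        Algebra.algebraMap_eq_smul_one, TensorProduct.smul_tmul]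
    | add z₁ z₂ h₁ h₂ =>
      obtain ⟨s₁, hs₁, ω₁, h₁⟩ := h₁
      obtain ⟨s₂, hs₂, ω₂, h₂⟩ := h₂
      refine ⟨s₁ * s₂, M.mul_mem hs₁ hs₂, s₂ • ω₁ + s₁ • ω₂, ?_⟩
      rw [map_mul, smul_add, mul_comm, mul_smul, h₁, mul_comm, mul_smul, h₂, TensorProduct.tmul_add,
        TensorProduct.tmul_smul, TensorProduct.tmul_smul, algebraMap_smul, algebraMap_smul]
  obtain ⟨s, hs, ω, h⟩ := key
  refine ⟨s, hs, ω, ?_⟩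
  rw [← map_smul, h, DiffForms.baseChangeEquiv_tmul, one_smul]

/-- Over a principal ideal domain `S` with fraction field `K`, there is a basis of `L` over `K` in
which multiplications by elements of the finite algebra `B` have matrices with entries in `S`. -/
theorem exists_basis_leftMulMatrix_mem_range (A B K L S : Type*) [CommRing A]
    [IsDomain A] [CommRing B] [IsDomain B] [Algebra A B] [Module.Finite A B]
    [Field K] [Algebra A K] [Field L] [Algebra B L] [IsFractionRing B L]
    [Algebra A L] [IsScalarTower A B L] [Algebra K L] [IsScalarTower A K L]
    [CommRing S] [IsDomain S] [IsPrincipalIdealRing S] [Algebra A S] [Algebra S K]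
    [IsScalarTower A S K] [IsFractionRing S K] [FaithfulSMul A B] :
    ∃ (r : ℕ) (e : Module.Basis (Fin r) K L), ∀ (b : B) i j,
      Algebra.leftMulMatrix e (algebraMap B L b) i j ∈ (algebraMap S K).range := by
  let _ : Algebra S L := ((algebraMap K L).comp (algebraMap S K)).toAlgebra
  have : IsScalarTower S K L := IsScalarTower.of_algebraMap_eq' rfl
  have : IsScalarTower A S L := IsScalarTower.of_algebraMap_eq fun a => by
    rw [IsScalarTower.algebraMap_apply S K L, ← IsScalarTower.algebraMap_apply A S K,
      ← IsScalarTower.algebraMap_apply A K L]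
  have : FaithfulSMul S L := by
    rw [faithfulSMul_iff_algebraMap_injective, IsScalarTower.algebraMap_eq S K L]
    exact (algebraMap K L).injective.comp (IsFractionRing.injective S K)
  -- The lattice generated by `B`: stable under `B`, finite and torsion-free over `S`, hence free.
  let N : Submodule S L := Submodule.span S (Set.range (algebraMap B L))
  have hNmul : ∀ (b : B), ∀ x ∈ N, algebraMap B L b * x ∈ N := by
    intro b x hx
    induction hx using Submodule.span_induction with
    | mem y hy =>
      obtain ⟨c, rfl⟩ := hy
      exact Submodule.subset_span ⟨b * c, map_mul _ _ _⟩
    | zero => rw [mul_zero]; exact N.zero_mem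
    | add y z _ _ h₁ h₂ => rw [mul_add]; exact N.add_mem h₁ h₂
    | smul c y _ h => rw [mul_smul_comm]; exact N.smul_mem _ h
  have hfin : Module.Finite S N := by
    obtain ⟨g, hg⟩ := (Module.Finite.fg_top : (⊤ : Submodule A B).FG)
    rw [Module.Finite.iff_fg]
    classical
    refine ⟨g.image (algebraMap B L), le_antisymm ?_ ?_⟩
    · rw [Finset.coe_image]
      exact Submodule.span_mono (Set.image_subset_range _ _)
    · refine Submodule.span_le.2 ?_
      rintro _ ⟨b, rfl⟩
      have hb : b ∈ Submodule.span A (g : Set B) := hg ▸ Submodule.mem_top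
      induction hb using Submodule.span_induction with
      | mem y hy =>
        exact Submodule.subset_span (by rw [Finset.coe_image]; exact ⟨y, hy, rfl⟩)
      | zero => rw [map_zero]; exact Submodule.zero_mem _
      | add y z _ _ h₁ h₂ => rw [map_add]; exact Submodule.add_mem _ h₁ h₂
      | smul c y _ h =>
        rw [Algebra.smul_def, map_mul, ← IsScalarTower.algebraMap_apply A B L,
          IsScalarTower.algebraMap_apply A S L, ← Algebra.smul_def]
        exact Submodule.smul_mem _ _ h
  let eN := Module.finBasis S N
  let v : Fin (Module.finrank S N) → L := fun i => (eN i : L)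
  have hli : LinearIndependent K v :=
    (LinearIndependent.iff_fractionRing S K).1
      (eN.linearIndependent.map' N.subtype (Submodule.ker_subtype N))
  have hNK : ∀ x ∈ N, x ∈ Submodule.span K (Set.range v) := by
    intro x hx
    have : x = ∑ i, algebraMap S K (eN.repr ⟨x, hx⟩ i) • v i := by
      have h := congrArg N.subtype (eN.sum_repr ⟨x, hx⟩)
      rw [map_sum] at h
      simp only [algebraMap_smul]
      exact h.symm
    rw [this]
    exact Submodule.sum_mem _ fun i _ => Submodule.smul_mem _ _ (Submodule.subset_span ⟨i, rfl⟩)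
  have hsp : ⊤ ≤ Submodule.span K (Set.range v) := by
    intro l _
    obtain ⟨b, c, hc, rfl⟩ := IsFractionRing.div_surjective (A := B) l
    have hc0 := nonZeroDivisors.ne_zero hc
    -- Denominators can be taken in `A`: `b / c = b' / a`.
    obtain ⟨b', a, ha, hab⟩ := Algebra.IsAlgebraic.exists_smul_eq_mul A b hc0
    have haK : algebraMap A K a ≠ 0 := fun h => ha (by
      apply FaithfulSMul.algebraMap_injective A B
      apply IsFractionRing.injective B L
      rw [← IsScalarTower.algebraMap_apply A B L, IsScalarTower.algebraMap_apply A K L, h, map_zero,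
        map_zero, map_zero])
    have hcL : algebraMap B L c ≠ 0 := by
      rwa [Ne, IsFractionRing.to_map_eq_zero_iff]
    have : algebraMap B L b / algebraMap B L c = (algebraMap A K a)⁻¹ • algebraMap B L b' := by
      rw [eq_inv_smul_iff₀ haK, Algebra.smul_def, ← IsScalarTower.algebraMap_apply A K L, mul_div_assoc',
        div_eq_iff hcL, IsScalarTower.algebraMap_apply A B L, ← map_mul, ← map_mul,
        ← Algebra.smul_def, hab, mul_comm]
    rw [this]
    exact Submodule.smul_mem _ _ (hNK _ (Submodule.subset_span ⟨b', rfl⟩))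
  let e := Module.Basis.mk hli hsp
  refine ⟨_, e, fun b i j => ?_⟩
  have hx : algebraMap B L b * v j ∈ N := hNmul b _ (eN j).2
  refine ⟨eN.repr ⟨_, hx⟩ i, ?_⟩
  have hsum : algebraMap B L b * e j = ∑ l, algebraMap S K (eN.repr ⟨_, hx⟩ l) • e l := by
    have h := congrArg N.subtype (eN.sum_repr ⟨_, hx⟩)
    rw [map_sum] at h
    simp only [algebraMap_smul, e, Module.Basis.mk_apply]
    exact h.symm
  rw [Algebra.leftMulMatrix_eq_repr_mul, hsum, Module.Basis.repr_sum_self]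

end Localization

/-- The trace of a regular form is regular at the primes where the localization is a principal
ideal ring. -/
theorem exists_smul_formTrace_eq (k A B K L : Type*) [Field k] [CharZero k]
    [CommRing A] [IsDomain A] [CommRing B] [IsDomain B] [Field K] [Field L]
    [Algebra k A] [Algebra k B] [Algebra A B] [IsScalarTower k A B] [Module.Finite A B]
    [Algebra A K] [IsFractionRing A K] [Algebra B L] [IsFractionRing B L]
    [Algebra A L] [IsScalarTower A B L] [Algebra K L]
    [IsScalarTower A K L] [Algebra k K] [IsScalarTower k A K] [Algebra k L] [IsScalarTower k B L]
    [IsScalarTower k K L] [IsScalarTower k A L] [FaithfulSMul A B]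
    [Algebra.FormallyEtale A K] [Algebra.FormallyEtale B L] [Algebra.FormallyEtale K L]
    {n : ℕ} {ω : DiffForms k B} (hω : ω ∈ ⋀[B]^n (Ω[B⁄k])) (p : Ideal A) [p.IsPrime]
    (S : Type*) [CommRing S] [IsDomain S] [IsPrincipalIdealRing S] [Algebra A S] [Algebra k S]
    [IsScalarTower k A S] [IsLocalization.AtPrime S p] [Algebra S K] [IsScalarTower A S K]
    [IsScalarTower k S K] [IsFractionRing S K] :
    ∃ s ∉ p, ∃ y : DiffForms k A,
      algebraMap A K s • formTrace k A B K L (1 ⊗ₜ[B] ω) = 1 ⊗ₜ[A] y := by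
  obtain ⟨r, e, he⟩ := exists_basis_leftMulMatrix_mem_range A B K L S
  -- Here characteristic 0 is used to divide by `n!`.
  have hn : IsUnit (n.factorial : S) := by
    rw [← map_natCast (algebraMap k S)]
    exact (IsUnit.mk0 _ (Nat.cast_ne_zero.2 n.factorial_ne_zero)).map _
  obtain ⟨y, hy⟩ := baseChangeEquiv_formTrace_mem_range_pullback k A B K L S e he hn hω
  obtain ⟨s, hs, η, hη⟩ := exists_smul_eq_pullback k A S p.primeCompl y
  refine ⟨s, hs, η, ?_⟩
  have hy' : DiffForms.pullback k S K y =
    DiffForms.baseChangeEquiv k A K (formTrace k A B K L (1 ⊗ₜ[B] ω)) := hy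
  refine (DiffForms.baseChangeEquiv k A K).injective ?_
  rw [map_smul, ← hy', DiffForms.baseChangeEquiv_tmul, one_smul,
    ← DiffForms.pullback_pullback k A S K, ← hη, map_smul,
    IsScalarTower.algebraMap_apply A S K, algebraMap_smul]

end

/-- Let `k` be a field of characteristic `0`, `A` a smooth `k`-algebra that is a domain, `B` a
finite `A`-algebra that is a domain, and `K ⊆ L` the fraction fields of `A` and `B` (that `K → L`
extends `A → B` forces `A → B` to be injective). Then the trace `Tr_{B/A}` on meromorphic forms
exists, is unique, and sends regular forms of degree `n` on `B` to regular forms of degree `n`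
on `A`. -/
theorem mainTheorem4 {k A B K L : Type*} [Field k] [CharZero k]
    [CommRing A] [IsDomain A] [Algebra k A] [Algebra.Smooth k A]
    [CommRing B] [IsDomain B] [Algebra k B] [Algebra A B] [IsScalarTower k A B]
    [Module.Finite A B]
    [Field K] [Algebra A K] [IsFractionRing A K]
    [Field L] [Algebra B L] [IsFractionRing B L]
    [Algebra A L] [IsScalarTower A B L] [Algebra K L] [IsScalarTower A K L] :
    ∃ Tr : MeroForms k B L →+ MeroForms k A K,
      IsFormTrace k A B K L Tr ∧
      (∀ Tr' : MeroForms k B L →+ MeroForms k A K, IsFormTrace k A B K L Tr' → Tr' = Tr) ∧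
      ∀ (n : ℕ), ∀ ω ∈ ⋀[B]^n (Ω[B⁄k]), ∃ η ∈ ⋀[A]^n (Ω[A⁄k]),
        Tr ((1 : L) ⊗ₜ[B] ω) = (1 : K) ⊗ₜ[A] η := by
  let _ : Algebra k K := ((algebraMap A K).comp (algebraMap k A)).toAlgebra
  have : IsScalarTower k A K := IsScalarTower.of_algebraMap_eq' rfl
  let _ : Algebra k L := ((algebraMap B L).comp (algebraMap k B)).toAlgebra
  have : IsScalarTower k B L := IsScalarTower.of_algebraMap_eq' rfl
  have : IsScalarTower k A L := IsScalarTower.of_algebraMap_eq fun x => by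
    rw [IsScalarTower.algebraMap_apply k B L, IsScalarTower.algebraMap_apply k A B,
      ← IsScalarTower.algebraMap_apply A B L]
  have : IsScalarTower k K L := IsScalarTower.of_algebraMap_eq fun x => by
    rw [IsScalarTower.algebraMap_apply k A L, IsScalarTower.algebraMap_apply A K L,
      ← IsScalarTower.algebraMap_apply k A K]
  have hAB : FaithfulSMul A B := by
    rw [faithfulSMul_iff_algebraMap_injective]
    refine Function.Injective.of_comp (f := algebraMap B L) ?_
    rw [← RingHom.coe_comp, ← IsScalarTower.algebraMap_eq, IsScalarTower.algebraMap_eq A K L]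
    exact (algebraMap K L).injective.comp (IsFractionRing.injective A K)
  have : CharZero K := charZero_of_injective_algebraMap (algebraMap k K).injective
  have : FaithfulSMul A L := FaithfulSMul.trans A B L
  have : Algebra.IsAlgebraic K L :=
    IsFractionRing.comap_isAlgebraic_iff.1 ((IsFractionRing.isAlgebraic_iff' A B L).1 inferInstance)
  have : Algebra.IsSeparable K L := inferInstance
  have : Algebra.FormallyEtale K L := Algebra.FormallyEtale.of_isSeparable K L
  have : Algebra.FormallyEtale A K :=
    Algebra.FormallyEtale.of_isLocalization (nonZeroDivisors A)
  have : Algebra.FormallyEtale B L :=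
    Algebra.FormallyEtale.of_isLocalization (nonZeroDivisors B)
  have : Algebra.FormallyEtale A L := Algebra.FormallyEtale.comp A K L
  have : IsNoetherianRing A := Algebra.FiniteType.isNoetherianRing k A
  have : IsIntegrallyClosed A := isIntegrallyClosed_of_smooth k A
  refine ⟨formTrace k A B K L, isFormTrace_formTrace k A B K L,
    fun Tr' h' => (isFormTrace_formTrace k A B K L).unique h', fun n ω hω => ?_⟩
  obtain ⟨y, hy⟩ := exists_eq_one_tmul_of_forall_prime (formTrace k A B K L (1 ⊗ₜ[B] ω))
    fun p _ _ => exists_smul_formTrace_eq k A B K L hω p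
      (Localization.subalgebra K p.primeCompl p.primeCompl_le_nonZeroDivisors)
  -- The regular form `y` need not be homogeneous, but the trace is, so the degree `n` part of `y`
  -- serves.
  have hdeg := formTrace_mem_tensorDegree k A B K L hω
  rw [hy] at hdeg ⊢
  exact exists_mem_exteriorPower_of_mem_tensorDegree hdeg
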